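/- For $N\ge 1$ spins-$\tfrac12$ with Pauli matrices $\sigma_i^x,\sigma_i^z$ on $(\mathbb C^2)^{\otimes N}$, let $$H_{\rm Ising}=-\sum_{\emptyset\ne S\subseteq\{1,\dots,N\}}J_S\prod_{i\in S}\sigma_i^z\quad(J_S\in\mathbb R),\qquad H(g)=H_{\rm Ising}-g\sum_{i=1}^N\sigma_i^x ,$$ let $E_{\min},E_{\max}$ be the least and greatest eigenvalues of $H_{\rm Ising}$, and let $\varepsilon_0(g)$ be the least eigenvalue of $H(g)$. For a Hermitian operator $G$ and a vector $\psi$, let $x_G(\psi)$ be the norm of the component of $\psi$ orthogonal to the eigenspace of the least eigenvalue of $G$ (the excitation amplitude; its square is the excitation probability if $\|\psi\|=1$). Fix constants $\Gamma_0>0$ and $K,L\in\mathbb R$. There are constants $a_2$ and $a_1>0$ depending only on $\Gamma_0,K,L$ such that the following holds for all $N\ge 1$, all couplings $J$ with $-KN\le E_{\min}$ and $E_{\max}\le KN$ (extensivity), and all $E_+$ with $E_{\max}+\Gamma_0<E_+\le LN$. Put $$A=\frac{2(E_+-E_{\min})\,N!}{N\,(E_+-E_{\min}+N\Gamma_0)^N},\qquad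 a_*=\Bigl(\frac{N}{(2N-1)A^2}\Bigr)^{1/(2N-1)} .$$ 1. (Energy gap.) $A>0$, and for $0<g\le\Gamma_0$ the ground state of $H(g)$ is nondegenerate and every other eigenvalue $\varepsilon$ of $H(g)$ satisfies $$\varepsilon-\varepsilon_0(g)\ \ge\ \frac{2(E_+-\varepsilon_0(g))\,N!}{N\,(E_+-E_{\min}+N\Gamma_0)^N}\,g^N\ \ge\ A\,g^N .$$ 2. (Order $N^0$.) $a_1\le a_*\le a_2$. 3. (Annealing schedule.) There is a constant $C$ (depending on $N,J,E_+,\Gamma_0,K,L$) such that for all $a\ge a_*$ and $\delta>0$, with $\Gamma(t)=a(\delta t+c)^{-1/(2N-1)}$, the following holds. Call $(c,t_0)$ admissible if $\delta t_0+c>0$ and $\Gamma(t_0)\le\Gamma_0$; for each real $c$ all sufficiently large $t_0$ are admissible, and for each $t_0$ all sufficiently large $c$ are admissible. For every admissible $(c,t_0)$ with $t_0>0$: (a) for all $t>t_0$ the adiabaticity condition holds: the ground state of $H(\Gamma(t))$ is nondegenerate, and for every unit ground state $|0\rangle$ and every unit eigenvector $|j\rangle$ of $H(\Gamma(t))$ with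 eigenvalue $\varepsilon_j\ne\varepsilon_0(\Gamma(t))$, $$\frac{1}{(\varepsilon_j-\varepsilon_0(\Gamma(t)))^2}\Bigl|\langle j|\tfrac{d}{dt}H(\Gamma(t))|0\rangle\Bigr|\le\delta ;$$ (b) quantum annealing converges: if $\psi$ is continuous on $[t_0,\infty)$, $\|\psi(t_0)\|=1$ and $i\,\frac{d}{dt}\psi(t)=H(\Gamma(t))\psi(t)$ for $t>t_0$, then $$x_{H(\Gamma(t))}(\psi(t))\le x_{H(\Gamma(t_0))}(\psi(t_0))+C\delta\quad\text{for all }t\ge t_0,$$ $$\limsup_{t\to\infty}x_{H_{\rm Ising}}(\psi(t))\le x_{H(\Gamma(t_0))}(\psi(t_0))+C\delta .$$ In particular, if $\psi(t_0)$ is the ground state of $H(\Gamma(t_0))$, the probability of not being in the instantaneous ground state at any time $t\ge t_0$, and asymptotically that of not being in a ground state of $H_{\rm Ising}$, is at most $C^2\delta^2$ (asymptotically: its limsup), so it is arbitrarily small for small $\delta$. -/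

import Mathlib

open scoped Nat

/-- Configurations of `N` spins in the `σ^z`-basis: value `0` at a site means `σ^z = +1`,
value `1` means `σ^z = -1`. -/
abbrev SpinConfig (N : ℕ) : Type := Fin N → Fin 2

/-- The state space `(ℂ²)^{⊗ N}`, with its `σ^z`-basis indexed by the configurations. -/
abbrev StateSpace (N : ℕ) : Type := EuclideanSpace ℂ (SpinConfig N)

/-- Operators on `N` spins, as matrices in the `σ^z`-basis. -/
abbrev SpinOp (N : ℕ) : Type := Matrix (SpinConfig N) (SpinConfig N) ℂ

def pauliX : Matrix (Fin 2) (Fin 2) ℂ := !![0, 1; 1, 0]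

def pauliZ : Matrix (Fin 2) (Fin 2) ℂ := !![1, 0; 0, -1]

/-- The operator `1 ⊗ ⋯ ⊗ P ⊗ ⋯ ⊗ 1` with `P` acting on the spin at site `i`. -/
def siteOp {N : ℕ} (P : Matrix (Fin 2) (Fin 2) ℂ) (i : Fin N) : SpinOp N :=
  Matrix.of fun x y => if ∀ j, j ≠ i → x j = y j then P (x i) (y i) else 0

/-- The general Ising Hamiltonian `-∑ᵢ Jᵢ σᵢᶻ - ∑ᵢⱼ Jᵢⱼ σᵢᶻσⱼᶻ - ∑ᵢⱼₖ Jᵢⱼₖ σᵢᶻσⱼᶻσₖᶻ - ⋯`, with one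
real coupling for every nonempty set of sites. (The factors commute; they are listed in
increasing order of the sites.) -/
noncomputable def isingHamiltonian {N : ℕ} (J : Finset (Fin N) → ℝ) : SpinOp N :=
  -∑ S : Finset (Fin N) with S.Nonempty,
    (J S : ℂ) • ((S.sort (· ≤ ·)).map (siteOp pauliZ)).prod

/-- The transverse-field Ising Hamiltonian `H_Ising - g ∑ᵢ σᵢˣ` at field strength `g`. -/
noncomputable def tfimHamiltonian {N : ℕ} (J : Finset (Fin N) → ℝ) (g : ℝ) : SpinOp N :=
  isingHamiltonian J - (g : ℂ) • ∑ i : Fin N, siteOp pauliX i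

/-- The real eigenvalues of an operator (all of them, for a Hermitian one). -/
def energyLevels {N : ℕ} (H : SpinOp N) : Set ℝ :=
  {e | Module.End.HasEigenvalue (Matrix.toEuclideanLin H) (e : ℂ)}

noncomputable def minEnergy {N : ℕ} (H : SpinOp N) : ℝ := sInf (energyLevels H)

noncomputable def maxEnergy {N : ℕ} (H : SpinOp N) : ℝ := sSup (energyLevels H)

/-- The space of eigenvectors for the eigenvalue `e`. -/
noncomputable def energySpace {N : ℕ} (H : SpinOp N) (e : ℝ) : Submodule ℂ (StateSpace N) :=
  Module.End.eigenspace (Matrix.toEuclideanLin H) (e : ℂ)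

noncomputable def groundSpace {N : ℕ} (H : SpinOp N) : Submodule ℂ (StateSpace N) :=
  energySpace H (minEnergy H)

/-- The norm of the component of `ψ` orthogonal to the ground space of `H`. For a unit vector its
square is the excitation probability. -/
noncomputable def excitationAmplitude {N : ℕ} (H : SpinOp N) (ψ : StateSpace N) : ℝ :=
  ‖ψ - (groundSpace H).starProjection ψ‖

/-- `ψ` solves `i dψ/dt = H(t) ψ` for `t > t₀` and is continuous up to `t₀`. -/
def SolvesSchrodinger {N : ℕ} (H : ℝ → SpinOp N) (t₀ : ℝ) (ψ : ℝ → StateSpace N) : Prop :=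
  ContinuousOn ψ (Set.Ici t₀) ∧
    ∀ t, t₀ < t → ∃ ψ' : StateSpace N, HasDerivAt ψ ψ' t ∧
      Complex.I • ψ' = Matrix.toEuclideanLin (H t) (ψ t)

/-- The adiabaticity condition at time `t`: the ground state of `H(t)` is nondegenerate, `H` is
differentiable at `t`, and `|⟨j(t)| dH/dt |0(t)⟩| / Δ_j(t)² ≤ δ` for every unit ground state
`|0(t)⟩` and every unit excited eigenstate `|j(t)⟩`. -/
def AdiabaticAt {N : ℕ} (H : ℝ → SpinOp N) (δ t : ℝ) : Prop :=
  Module.finrank ℂ (groundSpace (H t)) = 1 ∧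
  ∃ H' : SpinOp N, HasDerivAt H H' t ∧
    ∀ v₀ ∈ groundSpace (H t), ‖v₀‖ = 1 →
      ∀ e ∈ energyLevels (H t), e ≠ minEnergy (H t) →
        ∀ v ∈ energySpace (H t) e, ‖v‖ = 1 →
          ‖inner ℂ v (Matrix.toEuclideanLin H' v₀)‖ / (e - minEnergy (H t)) ^ 2 ≤ δ

/-- The schedule `Γ(t) = a (δ t + c)^{-1/(2N-1)}`. -/
noncomputable def powerSchedule (N : ℕ) (a c δ t : ℝ) : ℝ :=
  a * (δ * t + c) ^ (-(1 / (2 * (N : ℝ) - 1)))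

/-- `2 (E₊ - ε) N! / (N (E₊ - E_min + N Γ₀)^N)`. -/
noncomputable def gapCoeff (N : ℕ) (Eplus Emin Γ₀ ε : ℝ) : ℝ :=
  2 * (Eplus - ε) * (N ! : ℝ) / ((N : ℝ) * (Eplus - Emin + (N : ℝ) * Γ₀) ^ N)

/-- The prefactor `(N / ((2N-1) A²))^{1/(2N-1)}`. -/
noncomputable def schedulePrefactor (N : ℕ) (A : ℝ) : ℝ :=
  ((N : ℝ) / ((2 * (N : ℝ) - 1) * A ^ 2)) ^ (1 / (2 * (N : ℝ) - 1))

/-!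
The Hamiltonian `H(g)` is a real symmetric matrix: a diagonal matrix of classical energies minus `g`
times the adjacency matrix of the hypercube. All spectral questions are settled over `ℝ` and
transferred to the complex state space by `realOp`.

*Gap.* For `0 < g ≤ Γ₀` the matrix `E₊ - H(g)` has nonnegative entries and diagonal entries at least
`g`, so its `N`-th power dominates `gᴺ (1 + X)ᴺ`, where `X = ∑ᵢ σᵢˣ`. The entries of `(1 + X)ᴺ` count
lazy walks on the hypercube; they do not increase with the Hamming distance and are at
least `N!` at antipodes, hence at least `N!` throughout. Row sums bound the entries from above,
and Hopf's theorem (`hopf_bound`) separates the Perron eigenvalue of the `N`-th power from the others.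
Bernoulli's inequality gives `gap_bound`. The same bound shows that the ground state is
nondegenerate.

*Prefactor.* The bounds follow from `(N/e)ᴺ ≤ N! ≤ Nᴺ`.

*Adiabaticity.* The schedule satisfies `Γ' = -β Γ²ᴺ`, where `β` is proportional to `δ`, so the square
of the gap bound `A Γᴺ` cancels the speed of the schedule exactly.

*Convergence.* With `P` the ground state projection and `S` the reduced resolvent,
`R = S (dP/dt) P` solves `(H - ε₀) R = (dP/dt) P`. If `ψ` solves the Schrödinger equation, then the
norm of `(1 - P) ψ - i R ψ` grows at most by the total variation of `R` (`adiabatic_estimate`). Along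
the schedule `R = -β G(Γ)` with `G(g) = g²ᴺ S² X P`, so it suffices that `G` is bounded and of bounded
variation on `(0, Γ₀]`. It is bounded because the entries of `S` are at most
`1 / (A gᴺ)`. Estimates of the derivative of `G`
by powers of `S` diverge as `g → 0`; instead, the entries of `G` and of its derivative are algebraic
functions of `g`, so the derivative has a constant sign near `0` (`exists_sign_of_mem_tameRing`) and
a bounded function that is monotone near `0` has bounded variation there. Algebraicity is inherited
from the ground energy, a root of the characteristic polynomial, because `P` and `S` are rational
expressions in `g`, the ground energy and the inverse of a bordered matrix. Finally, as `g → 0` the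
ground state of `H(g)` concentrates on the classical ground configurations.
-/

section

open Matrix

/-! ### Real symmetric matrices as Hamiltonians -/

section RealEigen

variable {ι : Type*} [Fintype ι]

lemma map_ofReal_mulVec_eq_smul_iff (M : Matrix ι ι ℝ) (e : ℝ) (v : ι → ℂ) :
    M.map Complex.ofRealHom *ᵥ v = (e : ℂ) • v ↔
      M *ᵥ (fun x => (v x).re) = e • (fun x => (v x).re) ∧
        M *ᵥ (fun x => (v x).im) = e • (fun x => (v x).im) := by
  simp only [funext_iff, Complex.ext_iff, ← forall_and]
  refine forall_congr' fun x => ?_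
  simp [mulVec, dotProduct]

variable [DecidableEq ι]

lemma mem_spectrum_iff_exists_mulVec (M : Matrix ι ι ℝ) (e : ℝ) :
    e ∈ spectrum ℝ M ↔ ∃ f : ι → ℝ, f ≠ 0 ∧ M *ᵥ f = e • f := by
  rw [← Matrix.spectrum_toLin', ← Module.End.hasEigenvalue_iff_mem_spectrum]
  constructor
  · intro h
    obtain ⟨f, hf⟩ := h.exists_hasEigenvector
    exact ⟨f, hf.2, by simpa using hf.apply_eq_smul⟩
  · rintro ⟨f, hf, h⟩
    exact Module.End.hasEigenvalue_of_hasEigenvector (x := f)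
      ⟨Module.End.mem_eigenspace_iff.2 (by simpa using h), hf⟩

/-- A symmetric matrix all of whose eigenvalues are nonnegative is positive semidefinite. -/
lemma posSemidef_of_forall_eigenvalue_nonneg {M : Matrix ι ι ℝ} (hM : M.IsHermitian)
    (h : ∀ (e : ℝ) (f : ι → ℝ), f ≠ 0 → M *ᵥ f = e • f → 0 ≤ e) : M.PosSemidef := by
  rw [hM.posSemidef_iff_eigenvalues_nonneg]
  intro i
  have : hM.eigenvalues i ∈ spectrum ℝ M := by
    rw [hM.spectrum_real_eq_range_eigenvalues]; exact ⟨i, rfl⟩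
  obtain ⟨f, hf, h'⟩ := (mem_spectrum_iff_exists_mulVec M _).1 this
  exact h _ f hf h'

/-- The entries of a positive semidefinite matrix are bounded by its diagonal. -/
lemma abs_apply_le_of_posSemidef {M : Matrix ι ι ℝ} (hM : M.PosSemidef) {b : ℝ}
    (hb : ∀ x, M x x ≤ b) (x y : ι) : |M x y| ≤ b := by
  have hs : M y x = M x y := by simpa using hM.1.apply x y
  have key : ∀ c : ℝ, 0 ≤ M x x + 2 * c * M x y + c ^ 2 * M y y := by
    intro c
    have := (posSemidef_iff_dotProduct_mulVec.1 hM).2 (Pi.single x 1 + c • Pi.single y 1)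
    simp [mulVec_add, mulVec_smul, add_dotProduct] at this
    rw [hs] at this
    linarith
  have h1 := key 1
  have h2 := key (-1)
  have := hb x
  have := hb y
  rw [abs_le]; constructor <;> linarith

lemma sub_smul_one_mulVec (M : Matrix ι ι ℝ) (e : ℝ) (f : ι → ℝ) :
    (M - e • (1 : Matrix ι ι ℝ)) *ᵥ f = M *ᵥ f - e • f := by
  rw [sub_mulVec, smul_mulVec, one_mulVec]

end RealEigen

section Levels

variable {N : ℕ}

lemma mem_energySpace_iff (H : SpinOp N) (e : ℝ) (v : StateSpace N) :
    v ∈ energySpace H e ↔ H *ᵥ v.ofLp = (e : ℂ) • v.ofLp := by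
  rw [energySpace, Module.End.mem_eigenspace_iff]
  constructor
  · intro h
    simpa using congrArg WithLp.ofLp h
  · intro h
    ext x
    simpa using congrFun h x

lemma mem_energyLevels_map_iff (M : Matrix (SpinConfig N) (SpinConfig N) ℝ) (e : ℝ) :
    e ∈ energyLevels (M.map Complex.ofRealHom) ↔
      ∃ f : SpinConfig N → ℝ, f ≠ 0 ∧ M *ᵥ f = e • f := by
  constructor
  · intro h
    obtain ⟨v, hv, hv0⟩ := Module.End.HasEigenvalue.exists_hasEigenvector h
    have hv' := (mem_energySpace_iff _ e v).1 hv
    rw [map_ofReal_mulVec_eq_smul_iff] at hv'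
    by_cases hre : (fun x => (v.ofLp x).re) = 0
    · refine ⟨_, fun him => hv0 ?_, hv'.2⟩
      ext x
      exact Complex.ext (congrFun hre x) (congrFun him x)
    · exact ⟨_, hre, hv'.1⟩
  · rintro ⟨f, hf, h⟩
    refine Module.End.hasEigenvalue_of_hasEigenvector (x := WithLp.toLp 2 fun x => (f x : ℂ)) ⟨?_, ?_⟩
    · refine (mem_energySpace_iff _ e _).2 ?_
      rw [map_ofReal_mulVec_eq_smul_iff]
      refine ⟨by simpa using h, ?_⟩
      ext x; simp [mulVec, dotProduct]
    · intro h0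
      apply hf
      ext x
      simpa using congrFun (congrArg WithLp.ofLp h0) x

lemma energyLevels_map_eq_spectrum (M : Matrix (SpinConfig N) (SpinConfig N) ℝ) :
    energyLevels (M.map Complex.ofRealHom) = spectrum ℝ M := by
  ext e; rw [mem_energyLevels_map_iff, mem_spectrum_iff_exists_mulVec]

variable {M : Matrix (SpinConfig N) (SpinConfig N) ℝ}

lemma energyLevels_finite (hM : M.IsHermitian) :
    (energyLevels (M.map Complex.ofRealHom)).Finite := by
  rw [energyLevels_map_eq_spectrum, hM.spectrum_real_eq_range_eigenvalues]
  exact Set.finite_range _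

lemma energyLevels_nonempty (hM : M.IsHermitian) :
    (energyLevels (M.map Complex.ofRealHom)).Nonempty := by
  rw [energyLevels_map_eq_spectrum, hM.spectrum_real_eq_range_eigenvalues]
  exact Set.range_nonempty _

lemma minEnergy_mem (hM : M.IsHermitian) :
    minEnergy (M.map Complex.ofRealHom) ∈ energyLevels (M.map Complex.ofRealHom) :=
  (energyLevels_nonempty hM).csInf_mem (energyLevels_finite hM)

lemma minEnergy_le (hM : M.IsHermitian) {e : ℝ} {f : SpinConfig N → ℝ} (hf : f ≠ 0)
    (h : M *ᵥ f = e • f) : minEnergy (M.map Complex.ofRealHom) ≤ e :=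
  csInf_le (energyLevels_finite hM).bddBelow ((mem_energyLevels_map_iff M e).2 ⟨f, hf, h⟩)

lemma le_maxEnergy (hM : M.IsHermitian) {e : ℝ} {f : SpinConfig N → ℝ} (hf : f ≠ 0)
    (h : M *ᵥ f = e • f) : e ≤ maxEnergy (M.map Complex.ofRealHom) :=
  le_csSup (energyLevels_finite hM).bddAbove ((mem_energyLevels_map_iff M e).2 ⟨f, hf, h⟩)

lemma posSemidef_sub_minEnergy (hM : M.IsHermitian) :
    (M - minEnergy (M.map Complex.ofRealHom) • (1 : Matrix _ _ ℝ)).PosSemidef := by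
  refine posSemidef_of_forall_eigenvalue_nonneg (hM.sub ?_) fun e f hf h => ?_
  · ext; simp [Matrix.one_apply, eq_comm]
  · rw [sub_smul_one_mulVec] at h
    have := minEnergy_le hM (e := e + minEnergy (M.map Complex.ofRealHom)) hf
      (by rw [add_smul, ← h]; abel)
    linarith

/-- The variational principle. -/
lemma minEnergy_mul_le (hM : M.IsHermitian) (f : SpinConfig N → ℝ) :
    minEnergy (M.map Complex.ofRealHom) * (f ⬝ᵥ f) ≤ f ⬝ᵥ M *ᵥ f := by
  have := (posSemidef_iff_dotProduct_mulVec.1 (posSemidef_sub_minEnergy hM)).2 f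
  rw [sub_smul_one_mulVec] at this
  simp [dotProduct_sub] at this
  linarith

/-- Vectors attaining the minimum in the variational principle are ground states. -/
lemma mulVec_eq_of_dotProduct_le (hM : M.IsHermitian) (f : SpinConfig N → ℝ)
    (h : f ⬝ᵥ M *ᵥ f ≤ minEnergy (M.map Complex.ofRealHom) * (f ⬝ᵥ f)) :
    M *ᵥ f = minEnergy (M.map Complex.ofRealHom) • f := by
  have h1 := ((posSemidef_sub_minEnergy hM).dotProduct_mulVec_zero_iff f).1 (by
    rw [sub_smul_one_mulVec]
    have := minEnergy_mul_le hM f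
    simp [dotProduct_sub]
    linarith)
  rw [sub_smul_one_mulVec] at h1
  exact sub_eq_zero.1 h1

end Levels

/-! ### Spin flips and the transverse field -/

section Flip

variable {N : ℕ}

/-- The configuration with the spin at site `i` reversed. -/
def spinFlip (i : Fin N) (x : SpinConfig N) : SpinConfig N := Function.update x i (x i + 1)

lemma fin_two_add_one_add_one (a : Fin 2) : a + 1 + 1 = a := by
  fin_cases a <;> rfl

lemma fin_two_add_one_ne (a : Fin 2) : a + 1 ≠ a := by
  fin_cases a <;> decide

lemma fin_two_eq_add_one_of_ne {a b : Fin 2} (h : a ≠ b) : b = a + 1 := by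
  revert h; revert a b; decide

@[simp] lemma spinFlip_same (i : Fin N) (x : SpinConfig N) : spinFlip i x i = x i + 1 := by
  simp [spinFlip]

lemma spinFlip_of_ne {i j : Fin N} (h : j ≠ i) (x : SpinConfig N) : spinFlip i x j = x j := by
  simp [spinFlip, h]

@[simp] lemma spinFlip_spinFlip (i : Fin N) (x : SpinConfig N) :
    spinFlip i (spinFlip i x) = x := by
  ext j
  by_cases h : j = i
  · subst h; simp [fin_two_add_one_add_one]
  · simp [spinFlip_of_ne h]

lemma spinFlip_comm (i j : Fin N) (x : SpinConfig N) :
    spinFlip i (spinFlip j x) = spinFlip j (spinFlip i x) := by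
  ext k
  by_cases hi : k = i <;> by_cases hj : k = j
  · subst hi; subst hj; rfl
  · subst hi; simp [spinFlip_of_ne hj]
  · subst hj; simp [spinFlip_of_ne hi]
  · simp [spinFlip_of_ne hi, spinFlip_of_ne hj]

lemma eq_spinFlip_iff {i : Fin N} {x y : SpinConfig N} : y = spinFlip i x ↔ x = spinFlip i y := by
  constructor <;> rintro rfl <;> simp

/-- `∑ᵢ σᵢˣ` as a real matrix: the adjacency matrix of the hypercube. -/
def hopping (N : ℕ) : Matrix (SpinConfig N) (SpinConfig N) ℝ :=
  Matrix.of fun x y => ∑ i : Fin N, if y = spinFlip i x then 1 else 0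

lemma hopping_mulVec (f : SpinConfig N → ℝ) (x : SpinConfig N) :
    (hopping N *ᵥ f) x = ∑ i, f (spinFlip i x) := by
  simp only [mulVec, dotProduct, hopping, of_apply, Finset.sum_mul]
  rw [Finset.sum_comm]
  simp

lemma hopping_isHermitian : (hopping N).IsHermitian := by
  ext x y
  simp only [conjTranspose_apply, hopping, of_apply, star_trivial]
  exact Finset.sum_congr rfl fun i _ => by simp only [eq_spinFlip_iff (x := x)]

lemma hopping_nonneg (x y : SpinConfig N) : 0 ≤ hopping N x y := by
  rw [hopping, of_apply]
  exact Finset.sum_nonneg fun i _ => by split_ifs <;> norm_num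

/-- The Hamiltonian with classical energies `E` in a transverse field `g`, as a real matrix. -/
def realTfim (E : SpinConfig N → ℝ) (g : ℝ) : Matrix (SpinConfig N) (SpinConfig N) ℝ :=
  diagonal E - g • hopping N

lemma realTfim_mulVec (E : SpinConfig N → ℝ) (g : ℝ) (f : SpinConfig N → ℝ) (x : SpinConfig N) :
    (realTfim E g *ᵥ f) x = E x * f x - g * ∑ i, f (spinFlip i x) := by
  rw [realTfim, sub_mulVec, smul_mulVec, Pi.sub_apply, Pi.smul_apply, hopping_mulVec,
    mulVec_diagonal, smul_eq_mul]

lemma realTfim_isHermitian (E : SpinConfig N → ℝ) (g : ℝ) : (realTfim E g).IsHermitian := by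
  refine (isHermitian_diagonal_of_self_adjoint _ ?_).sub ?_
  · ext; simp
  · have := hopping_isHermitian (N := N)
    unfold Matrix.IsHermitian at *
    rw [conjTranspose_smul, this, star_trivial]

lemma siteOp_pauliX (i : Fin N) :
    siteOp pauliX i = Matrix.of fun x y => if y = spinFlip i x then (1 : ℂ) else 0 := by
  ext x y
  simp only [siteOp, of_apply]
  by_cases h : y = spinFlip i x
  · subst h
    have h1 : ∀ j, j ≠ i → x j = spinFlip i x j := fun j hj => (spinFlip_of_ne hj x).symm
    rw [if_pos h1, if_pos rfl, spinFlip_same]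
    generalize x i = a
    fin_cases a <;> simp [pauliX]
  · rw [if_neg h]
    split_ifs with h1
    · have : y i = x i := by
        by_contra hne
        apply h
        ext j
        by_cases hj : j = i
        · subst hj; rw [spinFlip_same, fin_two_eq_add_one_of_ne (Ne.symm hne)]
        · rw [spinFlip_of_ne hj, h1 j hj]
      rw [this]
      generalize x i = a
      fin_cases a <;> simp [pauliX]
    · rfl

lemma sum_siteOp_pauliX : ∑ i : Fin N, siteOp pauliX i = (hopping N).map Complex.ofRealHom := by
  ext x y
  simp [Matrix.sum_apply, siteOp_pauliX, hopping]

lemma exists_siteOp_pauliZ (i : Fin N) :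
    ∃ E : SpinConfig N → ℝ, siteOp pauliZ i = diagonal fun x => (E x : ℂ) := by
  refine ⟨fun x => if x i = 0 then 1 else -1, ?_⟩
  ext x y
  by_cases h : x = y
  · subst h
    simp only [siteOp, of_apply, diagonal_apply_eq]
    generalize x i = a
    fin_cases a <;> simp [pauliZ]
  · rw [diagonal_apply_ne _ h]
    simp only [siteOp, of_apply]
    split_ifs with h1
    · have : x i ≠ y i := fun h2 => h (by
        ext j
        by_cases hj : j = i
        · subst hj; rw [h2]
        · rw [h1 j hj])
      revert this
      generalize x i = a
      generalize y i = b
      fin_cases a <;> fin_cases b <;> simp [pauliZ]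
    · rfl

/-- The Ising Hamiltonian is diagonal with real entries. -/
lemma exists_isingHamiltonian_eq (J : Finset (Fin N) → ℝ) :
    ∃ E : SpinConfig N → ℝ, isingHamiltonian J = (diagonal E).map Complex.ofRealHom := by
  choose D hD using exists_siteOp_pauliZ (N := N)
  have hprod : ∀ l : List (Fin N), ∃ E : SpinConfig N → ℝ,
      (l.map (siteOp pauliZ)).prod = (diagonal E).map Complex.ofRealHom := by
    intro l
    induction l with
    | nil => exact ⟨fun _ => 1, by simp⟩
    | cons i l ih =>
      obtain ⟨E, hE⟩ := ih
      refine ⟨fun x => D i x * E x, ?_⟩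
      rw [List.map_cons, List.prod_cons, hE, hD, diagonal_map (by simp), diagonal_mul_diagonal,
        diagonal_map (by simp)]
      simp
  choose F hF using hprod
  refine ⟨fun x => -∑ S : Finset (Fin N) with S.Nonempty, J S * F (S.sort (· ≤ ·)) x, ?_⟩
  ext x y
  rw [isingHamiltonian, Matrix.neg_apply, Matrix.sum_apply]
  by_cases h : x = y
  · subst h; simp [hF]
  · simp [hF, h]

lemma tfimHamiltonian_eq {J : Finset (Fin N) → ℝ} {E : SpinConfig N → ℝ}
    (hE : isingHamiltonian J = (diagonal E).map Complex.ofRealHom) (g : ℝ) :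
    tfimHamiltonian J g = (realTfim E g).map Complex.ofRealHom := by
  rw [tfimHamiltonian, hE, sum_siteOp_pauliX]
  ext x y
  by_cases h : x = y
  · subst h; simp [realTfim]
  · simp [realTfim, h]

end Flip

/-! ### Hopf's bound on the subdominant eigenvalues of a positive matrix -/

section Hopf

/-- The contraction estimate behind Hopf's bound: a cross ratio of at most `κ²` keeps two points
of `[0, 1]` within distance `(κ - 1) / (κ + 1)`. -/
lemma sub_mul_le_of_crossRatio_le {x y κ : ℝ} (hκ : 1 ≤ κ) (hx1 : x ≤ 1) (hy0 : 0 ≤ y)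
    (h : x * (1 - y) ≤ κ ^ 2 * (y * (1 - x))) :
    (x - y) * (κ + 1) ≤ κ - 1 := by
  have h2 : (1 + (x - y)) ^ 2 ≤ (κ * (1 - (x - y))) ^ 2 := by
    nlinarith [mul_nonneg (by nlinarith : (0:ℝ) ≤ κ ^ 2 - 1) (sq_nonneg (x + y - 1))]
  have := abs_le_of_sq_le_sq' h2 (mul_nonneg (by linarith) (by linarith))
  linarith [this.2]

/-- **Hopf's theorem**: if the rows of a positive matrix agree up
to the factor `κ`, every eigenvalue `μ` belonging to an eigenvector that is not proportional to the
Perron vector `p` satisfies `μ ≤ (κ - 1) / (κ + 1) * μ₀`, where `μ₀` is the Perron eigenvalue. -/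
lemma hopf_bound {ι : Type*} [Fintype ι] [Nonempty ι] {M : Matrix ι ι ℝ} {κ μ₀ μ : ℝ}
    {p f : ι → ℝ} (hκ : 1 ≤ κ) (hpos : ∀ i k, 0 < M i k) (hrow : ∀ i j k, M i k ≤ κ * M j k)
    (hp : ∀ i, 0 < p i) (hMp : M *ᵥ p = μ₀ • p) (hMf : M *ᵥ f = μ • f)
    (hne : ¬ ∃ c : ℝ, f = c • p) : μ * (κ + 1) ≤ (κ - 1) * μ₀ := by
  obtain ⟨h, hfk⟩ : ∃ h : ι → ℝ, ∀ k, f k = h k * p k :=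
    ⟨fun k => f k / p k, fun k => (div_mul_cancel₀ _ (hp k).ne').symm⟩
  obtain ⟨i, hi⟩ := Finite.exists_max h
  obtain ⟨j, hj⟩ := Finite.exists_min h
  have hlt : h j < h i := by
    by_contra hcon
    refine hne ⟨h j, funext fun k => ?_⟩
    have : h k = h j := le_antisymm ((hi k).trans (not_lt.1 hcon)) (hj k)
    rw [hfk, this]; rfl
  have hp' : ∀ l, ∑ k, M l k * p k = μ₀ * p l := fun l => congrFun hMp l
  have hf' : ∀ l, ∑ k, M l k * f k = μ * f l := fun l => congrFun hMf l
  have hμ₀ : 0 < μ₀ := by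
    have : 0 < μ₀ * p i := by
      rw [← hp' i]
      exact Finset.sum_pos (fun k _ => mul_pos (hpos i k) (hp k)) Finset.univ_nonempty
    exact pos_of_mul_pos_left this (hp i).le
  -- the numerators of the two averages of `h - h j` and of `h i - h`
  have hlow : ∀ l, ∑ k, M l k * ((h k - h j) * p k) = (μ * h l - h j * μ₀) * p l := fun l => by
    calc _ = ∑ k, (M l k * f k - h j * (M l k * p k)) :=
          Finset.sum_congr rfl fun k _ => by rw [hfk k]; ring
      _ = _ := by rw [Finset.sum_sub_distrib, ← Finset.mul_sum, hf', hp', hfk l]; ring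
  have hupp : ∀ l, ∑ k, M l k * ((h i - h k) * p k) = (h i * μ₀ - μ * h l) * p l := fun l => by
    calc _ = ∑ k, (h i * (M l k * p k) - M l k * f k) :=
          Finset.sum_congr rfl fun k _ => by rw [hfk k]; ring
      _ = _ := by rw [Finset.sum_sub_distrib, ← Finset.mul_sum, hf', hp', hfk l]; ring
  have hu : ∀ k, 0 ≤ (h k - h j) * p k := fun k => mul_nonneg (sub_nonneg.2 (hj k)) (hp k).le
  have hv : ∀ k, 0 ≤ (h i - h k) * p k := fun k => mul_nonneg (sub_nonneg.2 (hi k)) (hp k).le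
  have hcmp : ∀ (w : ι → ℝ), (∀ k, 0 ≤ w k) → ∀ l m,
      ∑ k, M l k * w k ≤ κ * ∑ k, M m k * w k := fun w hw l m => by
    rw [Finset.mul_sum]
    exact Finset.sum_le_sum fun k _ => by
      rw [← mul_assoc]; exact mul_le_mul_of_nonneg_right (hrow l m k) (hw k)
  have hsum0 : ∀ (w : ι → ℝ), (∀ k, 0 ≤ w k) → ∀ l, 0 ≤ ∑ k, M l k * w k := fun w hw l =>
    Finset.sum_nonneg fun k _ => mul_nonneg (hpos l k).le (hw k)
  have hcross := mul_le_mul (hcmp _ hu i j) (hcmp _ hv j i) (hsum0 _ hv j)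
    (mul_nonneg (by linarith) (hsum0 _ hu j))
  have n2 := hsum0 _ hu j
  have n3 := hsum0 _ hv i
  rw [hlow] at n2 hcross
  rw [hupp] at n3 hcross
  rw [hlow, hupp] at hcross
  replace n2 := nonneg_of_mul_nonneg_left n2 (hp j)
  replace n3 := nonneg_of_mul_nonneg_left n3 (hp i)
  have hω : 0 < μ₀ * (h i - h j) := mul_pos hμ₀ (sub_pos.2 hlt)
  have hc2 : (μ * h i - h j * μ₀) * (h i * μ₀ - μ * h j) ≤
      κ ^ 2 * ((μ * h j - h j * μ₀) * (h i * μ₀ - μ * h i)) := by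
    refine le_of_mul_le_mul_right ?_ (mul_pos (hp i) (hp j))
    linarith
  have hx : ∀ z, 1 - (μ * z - h j * μ₀) / (μ₀ * (h i - h j)) =
      (h i * μ₀ - μ * z) / (μ₀ * (h i - h j)) := fun z => by
    rw [eq_div_iff hω.ne', sub_mul, div_mul_cancel₀ _ hω.ne']; ring
  have key := sub_mul_le_of_crossRatio_le (x := (μ * h i - h j * μ₀) / (μ₀ * (h i - h j)))
    (y := (μ * h j - h j * μ₀) / (μ₀ * (h i - h j))) hκ
    (by rw [← sub_nonneg, hx]; exact div_nonneg n3 hω.le) (div_nonneg n2 hω.le)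
    (by
      rw [hx, hx, div_mul_div_comm, div_mul_div_comm, ← mul_div_assoc]
      exact div_le_div_of_nonneg_right hc2 (mul_pos hω hω).le)
  have h3 : (μ * h i - h j * μ₀) / (μ₀ * (h i - h j)) - (μ * h j - h j * μ₀) / (μ₀ * (h i - h j))
      = μ / μ₀ := by
    rw [← sub_div, div_eq_div_iff hω.ne' hμ₀.ne']; ring
  rw [h3, div_mul_eq_mul_div, div_le_iff₀ hμ₀] at key
  exact key

end Hopf

/-! ### Walks on the hypercube and the spectral gap -/

section Walks

variable {N : ℕ}

lemma one_add_hopping_pow_succ (n : ℕ) (x y : SpinConfig N) :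
    ((1 + hopping N) ^ (n + 1)) x y =
      ((1 + hopping N) ^ n) x y + ∑ i, ((1 + hopping N) ^ n) (spinFlip i x) y := by
  rw [pow_succ', add_mul, one_mul, Matrix.add_apply]
  congr 1
  exact hopping_mulVec (fun z => ((1 + hopping N) ^ n) z y) x

lemma one_add_hopping_pow_nonneg (n : ℕ) (x y : SpinConfig N) :
    0 ≤ ((1 + hopping N) ^ n) x y := by
  induction n generalizing x with
  | zero => rw [pow_zero, Matrix.one_apply]; split_ifs <;> norm_num
  | succ n ih =>
    rw [one_add_hopping_pow_succ]
    exact add_nonneg (ih x) (Finset.sum_nonneg fun i _ => ih _)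

/-- The number of lazy walks of a given length to `y` does not increase when the starting point is
moved away from `y`. -/
lemma one_add_hopping_pow_flip_le (n : ℕ) {x y : SpinConfig N} {i : Fin N} (h : x i = y i) :
    ((1 + hopping N) ^ n) (spinFlip i x) y ≤ ((1 + hopping N) ^ n) x y := by
  induction n generalizing x with
  | zero =>
    have hne : spinFlip i x ≠ y := fun h1 => fin_two_add_one_ne (x i) (by
      rw [← spinFlip_same, h1, h])
    rw [pow_zero, Matrix.one_apply_ne hne, Matrix.one_apply]
    split_ifs <;> norm_num
  | succ n ih =>
    rw [one_add_hopping_pow_succ, one_add_hopping_pow_succ,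
      ← Finset.add_sum_erase _ _ (Finset.mem_univ i),
      ← Finset.add_sum_erase _ (fun j => ((1 + hopping N) ^ n) (spinFlip j x) y)
        (Finset.mem_univ i), spinFlip_spinFlip]
    have : ∑ j ∈ Finset.univ.erase i, ((1 + hopping N) ^ n) (spinFlip j (spinFlip i x)) y ≤
        ∑ j ∈ Finset.univ.erase i, ((1 + hopping N) ^ n) (spinFlip j x) y :=
      Finset.sum_le_sum fun j hj => by
        rw [spinFlip_comm]
        exact ih (by rw [spinFlip_of_ne (Finset.ne_of_mem_erase hj).symm, h])
    linarith

/-- Between configurations at Hamming distance `n` there are at least `n!` walks of length `n`. -/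
lemma factorial_le_one_add_hopping_pow (n : ℕ) {x y : SpinConfig N} (h : hammingDist x y = n) :
    (n ! : ℝ) ≤ ((1 + hopping N) ^ n) x y := by
  induction n generalizing x with
  | zero =>
    rw [hammingDist_eq_zero.1 h]; simp
  | succ n ih =>
    rw [one_add_hopping_pow_succ]
    set D : Finset (Fin N) := Finset.univ.filter fun i => x i ≠ y i with hD
    have hcard : D.card = n + 1 := h
    have h1 : ∑ i ∈ D, (n ! : ℝ) ≤ ∑ i ∈ D, ((1 + hopping N) ^ n) (spinFlip i x) y := by
      refine Finset.sum_le_sum fun i hi => ih ?_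
      have : (Finset.univ.filter fun j => spinFlip i x j ≠ y j) = D.erase i := by
        ext j
        by_cases hj : j = i
        · subst hj
          have := fin_two_eq_add_one_of_ne (Finset.mem_filter.1 hi).2
          simp [this]
        · simp [hD, spinFlip_of_ne hj, hj]
      change (Finset.univ.filter fun j => spinFlip i x j ≠ y j).card = n
      rw [this, Finset.card_erase_of_mem hi, hcard]; rfl
    have h2 : ∑ i ∈ D, ((1 + hopping N) ^ n) (spinFlip i x) y ≤
        ∑ i, ((1 + hopping N) ^ n) (spinFlip i x) y :=
      Finset.sum_le_sum_of_subset_of_nonneg (Finset.subset_univ _) fun i _ _ =>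
        one_add_hopping_pow_nonneg _ _ _
    rw [Finset.sum_const, hcard, nsmul_eq_mul] at h1
    have h3 := one_add_hopping_pow_nonneg n x y
    rw [Nat.factorial_succ, Nat.cast_mul]
    linarith

/-- By monotonicity in the distance, antipodes are the worst case. -/
lemma factorial_le_one_add_hopping_pow_card (x y : SpinConfig N) :
    (N ! : ℝ) ≤ ((1 + hopping N) ^ N) x y := by
  -- move `x` away from `y` until it is the antipode of `y`
  obtain ⟨d, hd⟩ : ∃ d, d = N - hammingDist x y := ⟨_, rfl⟩
  have hle : ∀ x : SpinConfig N, hammingDist x y ≤ N := fun x => by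
    simpa using hammingDist_le_card_fintype (x := x) (y := y)
  induction d generalizing x with
  | zero => exact factorial_le_one_add_hopping_pow N (by have := hle x; omega)
  | succ d ih =>
    obtain ⟨i, hi⟩ : ∃ i, x i = y i := by
      by_contra hcon
      push Not at hcon
      have : hammingDist x y = N := by
        change (Finset.univ.filter fun j => x j ≠ y j).card = N
        rw [Finset.filter_true_of_mem fun i _ => hcon i]; simp
      omega
    refine (ih (spinFlip i x) ?_).trans (one_add_hopping_pow_flip_le N hi)
    have : hammingDist (spinFlip i x) y = hammingDist x y + 1 := by
      change (Finset.univ.filter fun j => spinFlip i x j ≠ y j).card =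
        (Finset.univ.filter fun j => x j ≠ y j).card + 1
      rw [← Finset.card_insert_of_notMem (a := i) (by simp [hi])]
      congr 1
      ext j
      by_cases hj : j = i
      · subst hj; simp [hi]
      · simp [spinFlip_of_ne hj, hj]
    omega

end Walks

section Gap

variable {N : ℕ} {E : SpinConfig N → ℝ} {Ep Em g : ℝ}

/-- The entrywise nonnegative matrix `Ep - H(g)`. -/
def shiftedTfim (E : SpinConfig N → ℝ) (Ep g : ℝ) : Matrix (SpinConfig N) (SpinConfig N) ℝ :=
  Ep • 1 - realTfim E g

lemma shifted_pow_succ (n : ℕ) (x y : SpinConfig N) :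
    (shiftedTfim E Ep g ^ (n + 1)) x y =
      (Ep - E x) * (shiftedTfim E Ep g ^ n) x y +
        g * ∑ i, (shiftedTfim E Ep g ^ n) (spinFlip i x) y := by
  nth_rw 1 [pow_succ', shiftedTfim]
  rw [sub_mul, smul_mul_assoc, one_mul, Matrix.sub_apply, Matrix.smul_apply]
  have := realTfim_mulVec E g (fun z => (shiftedTfim E Ep g ^ n) z y) x
  have h2 : (realTfim E g * shiftedTfim E Ep g ^ n) x y =
    (realTfim E g *ᵥ (fun z => (shiftedTfim E Ep g ^ n) z y)) x := rfl
  rw [h2, this, smul_eq_mul]; ring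

lemma le_shifted_pow (hg : 0 ≤ g) (hE : ∀ x, g ≤ Ep - E x) (n : ℕ) (x y : SpinConfig N) :
    g ^ n * ((1 + hopping N) ^ n) x y ≤ (shiftedTfim E Ep g ^ n) x y := by
  induction n generalizing x with
  | zero => simp
  | succ n ih =>
    rw [shifted_pow_succ, one_add_hopping_pow_succ, mul_add]
    refine add_le_add ?_ ?_
    · calc g ^ (n + 1) * ((1 + hopping N) ^ n) x y = g * (g ^ n * ((1 + hopping N) ^ n) x y) := by
            ring
        _ ≤ _ := mul_le_mul (hE x) (ih x)
            (mul_nonneg (pow_nonneg hg n) (one_add_hopping_pow_nonneg _ _ _)) (hg.trans (hE x))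
    · rw [pow_succ', mul_assoc, Finset.mul_sum]
      exact mul_le_mul_of_nonneg_left (Finset.sum_le_sum fun i _ => ih _) hg

lemma factorial_mul_pow_le_shifted_pow (hg : 0 ≤ g) (hE : ∀ x, g ≤ Ep - E x)
    (x y : SpinConfig N) :
    (N ! : ℝ) * g ^ N ≤ (shiftedTfim E Ep g ^ N) x y := by
  refine le_trans ?_ (le_shifted_pow hg hE N x y)
  rw [mul_comm]
  exact mul_le_mul_of_nonneg_left (factorial_le_one_add_hopping_pow_card x y) (pow_nonneg hg N)

lemma sum_shifted_pow_le (hg : 0 ≤ g) (hE : ∀ x, g ≤ Ep - E x) (hEm : ∀ x, Em ≤ E x)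
    (n : ℕ) (x : SpinConfig N) :
    ∑ y, (shiftedTfim E Ep g ^ n) x y ≤ (Ep - Em + N * g) ^ n := by
  induction n generalizing x with
  | zero => simp [Matrix.one_apply]
  | succ n ih =>
    have hnn : ∀ z, 0 ≤ ∑ y, (shiftedTfim E Ep g ^ n) z y := fun z =>
      Finset.sum_nonneg fun y _ => (mul_nonneg (pow_nonneg hg n)
        (one_add_hopping_pow_nonneg _ _ _)).trans (le_shifted_pow hg hE n z y)
    simp only [shifted_pow_succ, Finset.sum_add_distrib, ← Finset.mul_sum]
    rw [Finset.sum_comm, pow_succ', add_mul]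
    refine add_le_add (mul_le_mul (by linarith [hEm x]) (ih x) (hnn x) ?_) ?_
    · linarith [hE x, hEm x]
    · have : ∑ i : Fin N, ∑ y, (shiftedTfim E Ep g ^ n) (spinFlip i x) y ≤
          N * (Ep - Em + N * g) ^ n :=
        (Finset.sum_le_sum fun i _ => ih _).trans_eq (by simp)
      exact (mul_le_mul_of_nonneg_left this hg).trans_eq (by ring)

lemma shifted_mulVec {e : ℝ} {f : SpinConfig N → ℝ} (hf : realTfim E g *ᵥ f = e • f) (n : ℕ) :
    (shiftedTfim E Ep g ^ n) *ᵥ f = (Ep - e) ^ n • f := by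
  induction n with
  | zero => simp
  | succ n ih =>
    rw [pow_succ, ← mulVec_mulVec]
    nth_rw 2 [shiftedTfim]
    rw [sub_mulVec, smul_mulVec, one_mulVec, hf, ← sub_smul,
      mulVec_smul, ih, smul_smul, pow_succ']

/-- The gap bound: Hopf's theorem for the `N`-th power of `Ep - H(g)`, whose entries lie between
`N! gᴺ` and `(Ep - Em + N g)ᴺ`. -/
lemma gap_bound (hN : 1 ≤ N) (hg : 0 < g) (hE : ∀ x, g ≤ Ep - E x) (hEm : ∀ x, Em ≤ E x)
    {e₀ e : ℝ} {p f : SpinConfig N → ℝ} (hp : ∀ x, 0 < p x) (hHp : realTfim E g *ᵥ p = e₀ • p)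
    (hHf : realTfim E g *ᵥ f = e • f) (hne : ¬ ∃ c : ℝ, f = c • p) :
    0 < Ep - e₀ ∧
    2 * (Ep - e₀) * (N ! * g ^ N) ≤ N * (Ep - Em + N * g) ^ N * (e - e₀) := by
  set B := shiftedTfim E Ep g with hB
  set m : ℝ := N ! * g ^ N with hm
  set W : ℝ := (Ep - Em + N * g) ^ N with hW
  have hm0 : 0 < m := by positivity
  have hN1 : (1 : ℝ) ≤ N := by exact_mod_cast hN
  have hlow : ∀ x y, m ≤ (B ^ N) x y := factorial_mul_pow_le_shifted_pow hg.le hE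
  have hupp : ∀ x y, (B ^ N) x y ≤ W - m := fun x y => by
    have h1 := sum_shifted_pow_le hg.le hE hEm N x
    have hne : spinFlip ⟨0, hN⟩ y ≠ y := fun h => fin_two_add_one_ne (y ⟨0, hN⟩) (by
      rw [← spinFlip_same, h])
    have h2 : (B ^ N) x y + (B ^ N) x (spinFlip ⟨0, hN⟩ y) ≤ ∑ z, (B ^ N) x z := by
      rw [← Finset.sum_pair hne.symm]
      exact Finset.sum_le_sum_of_subset_of_nonneg (Finset.subset_univ _) fun z _ _ =>
        hm0.le.trans (hlow x z)
    have h3 := hlow x (spinFlip ⟨0, hN⟩ y)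
    linarith
  have h2m : m ≤ W - m := (hlow 0 0).trans (hupp 0 0)
  have he₀ : 0 < Ep - e₀ := by
    have h1 := congrFun hHp 0
    rw [realTfim_mulVec, Pi.smul_apply, smul_eq_mul] at h1
    have h2 : 0 ≤ g * ∑ i, p (spinFlip i 0) :=
      mul_nonneg hg.le (Finset.sum_nonneg fun i _ => (hp _).le)
    have h3 := hE 0
    have : 0 < (Ep - e₀) * p 0 := by nlinarith [hp 0]
    exact pos_of_mul_pos_left this (hp 0).le
  refine ⟨he₀, ?_⟩
  have hκ : 1 ≤ (W - m) / m := by rwa [one_le_div hm0]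
  have hκ1 : (W - m) / m + 1 = W / m := by field_simp; ring
  have key := hopf_bound (M := B ^ N) hκ (fun x y => hm0.trans_le (hlow x y))
    (fun x z y => (hupp x y).trans (by
      calc W - m = (W - m) / m * m := by field_simp
        _ ≤ _ := mul_le_mul_of_nonneg_left (hlow z y) (by linarith))) hp
    (shifted_mulVec hHp N) (shifted_mulVec hHf N) hne
  rcases le_total e Ep with h | h
  · -- Bernoulli's inequality turns the bound on the `N`-th powers into one on the eigenvalues
    set r := (Ep - e) / (Ep - e₀) with hr
    have hre : Ep - e = r * (Ep - e₀) := (div_mul_cancel₀ _ he₀.ne').symm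
    have hr0 : 0 ≤ r := div_nonneg (by linarith) he₀.le
    have hbern : 1 + (N : ℝ) * (r - 1) ≤ r ^ N := by
      have := one_add_mul_le_pow (a := r - 1) (by linarith) N
      simpa using this
    rw [hre, mul_pow, mul_right_comm] at key
    have key2 := le_of_mul_le_mul_right key (pow_pos he₀ N)
    have h4 : r ^ N * W ≤ W - 2 * m := by
      have h5 : r ^ N * (W / m) ≤ W / m - 2 := by rw [← hκ1]; linarith
      have h6 := mul_le_mul_of_nonneg_right h5 hm0.le
      rwa [mul_assoc, div_mul_cancel₀ _ hm0.ne', sub_mul, div_mul_cancel₀ _ hm0.ne'] at h6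
    have h7 : (1 + (N : ℝ) * (r - 1)) * W ≤ r ^ N * W :=
      mul_le_mul_of_nonneg_right hbern (by linarith)
    have h8 : e - e₀ = (1 - r) * (Ep - e₀) := by rw [sub_mul, ← hre]; ring
    rw [h8]
    have := mul_le_mul_of_nonneg_right (h4.trans' h7) he₀.le
    linarith
  · have h1 : 2 * m ≤ N * W := by nlinarith
    have h2 : Ep - e₀ ≤ e - e₀ := by linarith
    have := mul_le_mul h1 h2 he₀.le (by nlinarith)
    linarith

end Gap

/-! ### The ground state in a positive transverse field -/

section Ground

variable {N : ℕ}

/-- The ground-state energy in the transverse field `g`. -/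
noncomputable def groundEnergy (E : SpinConfig N → ℝ) (g : ℝ) : ℝ :=
  minEnergy ((realTfim E g).map Complex.ofRealHom)

lemma exists_shift (E : SpinConfig N → ℝ) (g : ℝ) : ∃ Ep, ∀ x, g ≤ Ep - E x := by
  obtain ⟨x, hx⟩ := Finite.exists_max E
  exact ⟨E x + g, fun y => by linarith [hx y]⟩

/-- **Perron–Frobenius**: replacing a ground vector by its entrywise modulus does not raise the
energy, so there is a nonnegative ground vector, and a power of `Ep - H(g)` with positive entries
makes it positive. -/
lemma exists_pos_groundVector (E : SpinConfig N → ℝ) {g : ℝ} (hg : 0 < g) :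
    ∃ p : SpinConfig N → ℝ, (∀ x, 0 < p x) ∧ realTfim E g *ᵥ p = groundEnergy E g • p := by
  have hH := realTfim_isHermitian E g
  obtain ⟨f, hf, hHf⟩ := (mem_energyLevels_map_iff _ _).1 (minEnergy_mem hH)
  set p : SpinConfig N → ℝ := fun x => |f x| with hp
  have hHp : realTfim E g *ᵥ p = groundEnergy E g • p := by
    refine mulVec_eq_of_dotProduct_le hH p ?_
    have h1 : p ⬝ᵥ p = f ⬝ᵥ f := Finset.sum_congr rfl fun x _ => abs_mul_abs_self _
    have h2 : f ⬝ᵥ realTfim E g *ᵥ f = minEnergy ((realTfim E g).map Complex.ofRealHom) *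
        (f ⬝ᵥ f) := by rw [hHf, dotProduct_smul, smul_eq_mul]
    rw [h1, ← h2]
    refine Finset.sum_le_sum fun x _ => ?_
    rw [realTfim_mulVec, realTfim_mulVec, mul_sub, mul_sub]
    have h3 : p x * (E x * p x) = f x * (E x * f x) := by
      have := abs_mul_abs_self (f x)
      simp only [hp]; linear_combination E x * this
    rw [h3]
    refine sub_le_sub_left ?_ _
    rw [mul_left_comm, mul_left_comm (p x)]
    refine mul_le_mul_of_nonneg_left ?_ hg.le
    rw [Finset.mul_sum, Finset.mul_sum]
    exact Finset.sum_le_sum fun i _ => (le_abs_self _).trans_eq (abs_mul _ _)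
  refine ⟨p, fun x => ?_, hHp⟩
  obtain ⟨Ep, hEp⟩ := exists_shift E g
  obtain ⟨y, hy⟩ : ∃ y, f y ≠ 0 := by
    by_contra hcon
    push Not at hcon
    exact hf (funext hcon)
  have hpow := congrFun (shifted_mulVec (Ep := Ep) hHp N) x
  have hlow := factorial_mul_pow_le_shifted_pow hg.le hEp (N := N)
  have hm : (0 : ℝ) < N ! * g ^ N := by positivity
  have hpos : 0 < (shiftedTfim E Ep g ^ N *ᵥ p) x :=
    Finset.sum_pos' (fun z _ => mul_nonneg (hm.le.trans (hlow x z)) (abs_nonneg _))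
      ⟨y, Finset.mem_univ _, mul_pos (hm.trans_le (hlow x y)) (abs_pos.2 hy)⟩
  refine lt_of_le_of_ne (abs_nonneg _) fun h0 => ?_
  rw [hpow, Pi.smul_apply, show p x = 0 from h0.symm, smul_zero] at hpos
  exact lt_irrefl _ hpos

/-- The ground state is nondegenerate. -/
lemma groundVector_unique {E : SpinConfig N → ℝ} (hN : 1 ≤ N) {g : ℝ} (hg : 0 < g)
    {p f : SpinConfig N → ℝ} (hp : ∀ x, 0 < p x)
    (hHp : realTfim E g *ᵥ p = groundEnergy E g • p)
    (hHf : realTfim E g *ᵥ f = groundEnergy E g • f) : ∃ c : ℝ, f = c • p := by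
  by_contra hne
  obtain ⟨Ep, hEp⟩ := exists_shift E g
  obtain ⟨z, hz⟩ := Finite.exists_min E
  obtain ⟨h1, h2⟩ := gap_bound hN hg hEp hz hp hHp hHf hne
  rw [sub_self, mul_zero] at h2
  have : 0 < 2 * (Ep - groundEnergy E g) * (N ! * g ^ N) := by positivity
  linarith

lemma groundEnergy_le (E : SpinConfig N → ℝ) (g : ℝ) (x : SpinConfig N) :
    groundEnergy E g ≤ E x := by
  have h := minEnergy_mul_le (realTfim_isHermitian E g) (Pi.single x 1)
  have h2 : ∀ i, x ≠ spinFlip i x := fun i h =>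
    fin_two_add_one_ne (x i) (by rw [← spinFlip_same, ← h])
  have h3 : realTfim E g x x = E x := by simp [realTfim, hopping, h2]
  simpa [h3, groundEnergy] using h

lemma finrank_groundSpace {E : SpinConfig N → ℝ} (hN : 1 ≤ N) {g : ℝ} (hg : 0 < g) :
    Module.finrank ℂ (groundSpace ((realTfim E g).map Complex.ofRealHom)) = 1 := by
  obtain ⟨p, hp, hHp⟩ := exists_pos_groundVector E hg
  have hmem : WithLp.toLp 2 (fun x => (p x : ℂ)) ∈
      groundSpace ((realTfim E g).map Complex.ofRealHom) := by
    rw [groundSpace, mem_energySpace_iff, map_ofReal_mulVec_eq_smul_iff]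
    refine ⟨by simp only [Complex.ofReal_re]; exact hHp, ?_⟩
    ext x; simp [mulVec, dotProduct]
  rw [finrank_eq_one_iff_of_nonzero' (⟨_, hmem⟩ : groundSpace _)]
  · rintro ⟨w, hw⟩
    rw [groundSpace, mem_energySpace_iff, map_ofReal_mulVec_eq_smul_iff] at hw
    obtain ⟨a, ha⟩ := groundVector_unique hN hg hp hHp hw.1
    obtain ⟨b, hb⟩ := groundVector_unique hN hg hp hHp hw.2
    refine ⟨⟨a, b⟩, Subtype.ext ?_⟩
    ext x
    have h1 := congrFun ha x
    have h2 := congrFun hb x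
    apply Complex.ext
    · simpa using h1.symm
    · simpa using h2.symm
  · intro h0
    have := congrFun (congrArg WithLp.ofLp (congrArg Subtype.val h0)) 0
    exact (hp 0).ne' (by simpa using this)

/-- The energies of the Ising Hamiltonian are the diagonal entries. -/
lemma minEnergy_diagonal_le (E : SpinConfig N → ℝ) (x : SpinConfig N) :
    minEnergy ((diagonal E).map Complex.ofRealHom) ≤ E x ∧
      E x ≤ maxEnergy ((diagonal E).map Complex.ofRealHom) := by
  have hD : (diagonal E).IsHermitian := isHermitian_diagonal_of_self_adjoint _ (by ext; simp)
  have h1 : Pi.single (M := fun _ => ℝ) x 1 ≠ 0 := by simp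
  have h2 : diagonal E *ᵥ Pi.single x 1 = E x • Pi.single x 1 := by
    ext y
    by_cases h : y = x
    · subst h; simp
    · simp [h]
  exact ⟨minEnergy_le hD h1 h2, le_maxEnergy hD h1 h2⟩

lemma exists_le_minEnergy_diagonal (E : SpinConfig N → ℝ) :
    ∃ x, E x ≤ minEnergy ((diagonal E).map Complex.ofRealHom) := by
  have hD : (diagonal E).IsHermitian := isHermitian_diagonal_of_self_adjoint _ (by ext; simp)
  obtain ⟨f, hf, h⟩ := (mem_energyLevels_map_iff _ _).1 (minEnergy_mem hD)
  obtain ⟨x, hx⟩ := Function.ne_iff.1 hf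
  have h1 := congrFun h x
  rw [mulVec_diagonal, Pi.smul_apply, smul_eq_mul] at h1
  exact ⟨x, (mul_right_cancel₀ hx h1).le⟩

lemma gapCoeff_mul_pow_le {E : SpinConfig N → ℝ} (hN : 1 ≤ N) {Ep Em Γ₀ g : ℝ} (hg : 0 < g)
    (hgΓ : g ≤ Γ₀) (hE : ∀ x, Γ₀ ≤ Ep - E x) (hEm : ∀ x, Em ≤ E x) {e : ℝ}
    (he : e ∈ energyLevels ((realTfim E g).map Complex.ofRealHom)) (hne : e ≠ groundEnergy E g) :
    gapCoeff N Ep Em Γ₀ (groundEnergy E g) * g ^ N ≤ e - groundEnergy E g := by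
  obtain ⟨p, hp, hHp⟩ := exists_pos_groundVector E hg
  obtain ⟨f, hf, hHf⟩ := (mem_energyLevels_map_iff _ _).1 he
  have hN1 : (1 : ℝ) ≤ N := by exact_mod_cast hN
  have hfp : ¬ ∃ c : ℝ, f = c • p := by
    rintro ⟨c, rfl⟩
    have h1 : (e - groundEnergy E g) • (c • p) = 0 := by
      rw [sub_smul, ← hHf, mulVec_smul, hHp, smul_comm, sub_self]
    rcases smul_eq_zero.1 h1 with h | h
    · exact hne (sub_eq_zero.1 h)
    · exact hf h
  obtain ⟨h1, h2⟩ := gap_bound hN hg (fun x => hgΓ.trans (hE x)) hEm hp hHp hHf hfp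
  have hW : 0 < Ep - Em + N * g := by
    have := hE 0; have := hEm 0; have : 0 < N * g := by positivity
    linarith
  have hWW : (Ep - Em + N * g) ^ N ≤ (Ep - Em + N * Γ₀) ^ N := by gcongr
  have hle : 0 ≤ e - groundEnergy E g := by
    have : 0 < 2 * (Ep - groundEnergy E g) * (N ! * g ^ N) := by positivity
    exact (pos_of_mul_pos_right (this.trans_le h2) (by positivity)).le
  have hWpos := pow_pos hW N
  rw [gapCoeff, div_mul_eq_mul_div, div_le_iff₀ (by nlinarith)]
  calc _ = 2 * (Ep - groundEnergy E g) * (N ! * g ^ N) := by ring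
    _ ≤ _ := h2
    _ ≤ N * (Ep - Em + N * Γ₀) ^ N * (e - groundEnergy E g) := by gcongr
    _ = _ := by ring

end Ground

/-! ### The prefactor of the schedule is of order one -/

section Prefactor

/-- A constant `c` is dominated by a power, with any positive exponent, of `max 1 c`. -/
lemma le_max_one_pow (c : ℝ) {n : ℕ} (hn : n ≠ 0) : c ≤ max 1 c ^ n :=
  (le_max_right 1 c).trans (le_self_pow₀ (le_max_left 1 c) hn)

lemma min_one_pow_le {c : ℝ} (hc : 0 ≤ c) {n : ℕ} (hn : n ≠ 0) : min 1 c ^ n ≤ c :=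
  (pow_le_of_le_one (le_min zero_le_one hc) (min_le_left 1 c) hn).trans (min_le_right 1 c)

lemma pow_le_exp_mul_factorial (N : ℕ) : (N : ℝ) ^ N ≤ Real.exp 1 ^ N * N ! := by
  have h := Real.pow_div_factorial_le_exp (N : ℝ) (Nat.cast_nonneg N) N
  rw [div_le_iff₀ (by positivity)] at h
  rwa [← Real.exp_nat_mul, mul_one]

/-- The bounds `a₁, a₂` hold for the `(2N - 1)`-th power `N / ((2N - 1) A²)` of the prefactor up to
factors that are polynomial in `N` or exponential in `N`; each of these lies between `(2N - 1)`-th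
powers of constants. -/
lemma schedulePrefactor_bounds (K L Γ₀ : ℝ) (hΓ₀ : 0 < Γ₀) :
    ∃ a₁ a₂ : ℝ, 0 < a₁ ∧ ∀ N : ℕ, 1 ≤ N → ∀ Em Ep A : ℝ, Γ₀ ≤ Ep - Em → -(K * N) ≤ Em →
      Ep ≤ L * N → A = gapCoeff N Ep Em Γ₀ Em →
      0 < A ∧ a₁ ≤ schedulePrefactor N A ∧ schedulePrefactor N A ≤ a₂ := by
  set b : ℝ := max 1 (Real.exp 1 * (K + L + Γ₀)) with hb
  set D : ℝ := |K + L| + 1 with hD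
  refine ⟨min 1 Γ₀ ^ 2 * min 1 (1 / (8 * D ^ 2)), b ^ 2 * max 1 (1 / Γ₀ ^ 2) * 8,
    by positivity, ?_⟩
  rintro N hN Em Ep A hW hK hL rfl
  have hN1 : (1 : ℝ) ≤ N := by exact_mod_cast hN
  set W := Ep - Em with hWdef
  have hW0 : 0 < W := hΓ₀.trans_le hW
  have hWle : W ≤ (K + L) * N := by rw [add_mul]; linarith
  have hKL : 0 < K + L := pos_of_mul_pos_left (hW0.trans_le hWle) (by positivity)
  have hf0 : (0 : ℝ) < N ! := by positivity
  set A := gapCoeff N Ep Em Γ₀ Em with hA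
  have hAeq : A = 2 * W * N ! / (N * (W + N * Γ₀) ^ N) := rfl
  have hA0 : 0 < A := by rw [hAeq]; positivity
  obtain ⟨m, hm⟩ : ∃ m, m = 2 * N - 1 := ⟨_, rfl⟩
  have hm0 : m ≠ 0 := by omega
  have hmN : 2 * (N : ℝ) - 1 = m := by rw [hm, Nat.cast_sub (by omega)]; push_cast; ring
  have hmle : 2 * N ≤ 2 * m := by omega
  have hm1 : (1 : ℝ) ≤ m := by exact_mod_cast (Nat.one_le_iff_ne_zero.2 hm0)
  set T : ℝ := N / (m * A ^ 2) with hT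
  have hT0 : 0 ≤ T := by positivity
  have hTeq : T = N ^ 3 / (4 * m * W ^ 2) * ((W + N * Γ₀) ^ N / N !) ^ 2 := by
    rw [hT, hAeq]; field_simp; ring
  have hpre : schedulePrefactor N A = T ^ (1 / (m : ℝ)) := by
    rw [schedulePrefactor, hmN]
  have hroot : ∀ z : ℝ, 0 ≤ z → (z ^ m) ^ (1 / (m : ℝ)) = z := fun z hz => by
    rw [one_div, Real.pow_rpow_inv_natCast hz hm0]
  refine ⟨hA0, ?_, ?_⟩
  · rw [hpre, ← hroot (min 1 Γ₀ ^ 2 * min 1 (1 / (8 * D ^ 2))) (by positivity)]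
    refine Real.rpow_le_rpow (by positivity) ?_ (by positivity)
    have h1 : (N : ℝ) ^ 3 / (4 * m * W ^ 2) ≥ 1 / (8 * D ^ 2) := by
      rw [ge_iff_le, div_le_div_iff₀ (by positivity) (by positivity), one_mul]
      have hWD : W ≤ D * N := hWle.trans
        (mul_le_mul_of_nonneg_right (by linarith [le_abs_self (K + L)]) (by positivity))
      have hW2 : W ^ 2 ≤ (D * N) ^ 2 := by gcongr
      have hm2 : (m : ℝ) ≤ 2 * N := by linarith
      calc 4 * m * W ^ 2 ≤ 4 * (2 * N) * (D * N) ^ 2 := by gcongr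
        _ = _ := by ring
    have h2 : Γ₀ ^ N ≤ (W + N * Γ₀) ^ N / N ! := by
      rw [le_div_iff₀ hf0]
      calc Γ₀ ^ N * N ! ≤ Γ₀ ^ N * (N : ℝ) ^ N := by
            gcongr; exact_mod_cast Nat.factorial_le_pow N
        _ = (N * Γ₀) ^ N := by rw [mul_pow]; ring
        _ ≤ _ := by gcongr; linarith
    rw [hTeq, mul_pow, mul_comm]
    refine mul_le_mul ((min_one_pow_le (by positivity) hm0).trans h1) ?_ (by positivity)
      (by positivity)
    calc (min 1 Γ₀ ^ 2) ^ m = min 1 Γ₀ ^ (2 * m) := by rw [pow_mul]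
      _ ≤ min 1 Γ₀ ^ (2 * N) := pow_le_pow_of_le_one (by positivity) (min_le_left _ _) hmle
      _ ≤ Γ₀ ^ (2 * N) := by gcongr; exact min_le_right _ _
      _ = (Γ₀ ^ N) ^ 2 := by rw [mul_comm, pow_mul]
      _ ≤ _ := by gcongr
  · rw [hpre, ← hroot (b ^ 2 * max 1 (1 / Γ₀ ^ 2) * 8) (by positivity)]
    refine Real.rpow_le_rpow hT0 ?_ (by positivity)
    have hN2 : (N : ℝ) ≤ 2 ^ N := by exact_mod_cast Nat.lt_two_pow_self.le
    have h8 : (N : ℝ) ^ 3 ≤ 8 ^ m := by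
      calc (N : ℝ) ^ 3 ≤ (2 ^ N) ^ 3 := by gcongr
        _ = 8 ^ N := by rw [← pow_mul, mul_comm, pow_mul]; norm_num
        _ ≤ _ := by gcongr <;> [norm_num; omega]
    have h1 : (N : ℝ) ^ 3 / (4 * m * W ^ 2) ≤ max 1 (1 / Γ₀ ^ 2) ^ m * 8 ^ m := by
      have : 1 / (4 * m * W ^ 2) ≤ 1 / Γ₀ ^ 2 := by
        refine one_div_le_one_div_of_le (by positivity) ?_
        have : Γ₀ ^ 2 ≤ W ^ 2 := by gcongr
        nlinarith [sq_nonneg W]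
      rw [div_eq_mul_one_div, mul_comm]
      gcongr
      exact this.trans (le_max_one_pow _ hm0)
    have hb1 : 1 ≤ b := le_max_left _ _
    have h2 : (W + N * Γ₀) ^ N / N ! ≤ b ^ N := by
      rw [div_le_iff₀ hf0]
      calc (W + N * Γ₀) ^ N ≤ ((K + L + Γ₀) * N) ^ N := by gcongr; linarith
        _ = (K + L + Γ₀) ^ N * (N : ℝ) ^ N := mul_pow _ _ _
        _ ≤ (K + L + Γ₀) ^ N * (Real.exp 1 ^ N * N !) := by
            gcongr; exact pow_le_exp_mul_factorial N
        _ = (Real.exp 1 * (K + L + Γ₀)) ^ N * N ! := by rw [mul_pow]; ring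
        _ ≤ _ := by gcongr; exact le_max_right _ _
    rw [hTeq]
    calc _ ≤ (max 1 (1 / Γ₀ ^ 2) ^ m * 8 ^ m) * (b ^ N) ^ 2 := by gcongr
      _ = (max 1 (1 / Γ₀ ^ 2) ^ m * 8 ^ m) * b ^ (2 * N) := by rw [← pow_mul, mul_comm N]
      _ ≤ (max 1 (1 / Γ₀ ^ 2) ^ m * 8 ^ m) * b ^ (2 * m) := by gcongr
      _ = _ := by rw [mul_pow, mul_pow, pow_mul]; ring

end Prefactor

/-! ### Algebraic functions of the field -/

section Algebraic

open Polynomial Set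

/-- Polynomials in `g` as functions on `(0, ∞)`. -/
noncomputable def polyEval : ℝ[X] →+* (Ioi (0 : ℝ) → ℝ) :=
  RingHom.pi fun g => evalRingHom (g : ℝ)

/-- The function `f` satisfies on `(0, ∞)` a nontrivial polynomial equation whose coefficients are
polynomials in the variable. -/
def IsAlgebraicFun (f : ℝ → ℝ) : Prop :=
  letI := polyEval.toAlgebra
  IsAlgebraic ℝ[X] fun g : Ioi (0 : ℝ) => f g

/-- The ring of functions that are continuous and algebraic on `(0, ∞)`. -/
noncomputable def tameRing : Subring (ℝ → ℝ) where
  carrier := {f | ContinuousOn f (Ioi 0) ∧ IsAlgebraicFun f}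
  mul_mem' hf hg := ⟨hf.1.mul hg.1, letI := polyEval.toAlgebra; IsAlgebraic.mul hf.2 hg.2⟩
  add_mem' hf hg := ⟨hf.1.add hg.1, letI := polyEval.toAlgebra; IsAlgebraic.add hf.2 hg.2⟩
  one_mem' := ⟨continuousOn_const, letI := polyEval.toAlgebra; isAlgebraic_one⟩
  zero_mem' := ⟨continuousOn_const, letI := polyEval.toAlgebra; isAlgebraic_zero⟩
  neg_mem' hf := ⟨hf.1.neg, letI := polyEval.toAlgebra; IsAlgebraic.neg hf.2⟩

lemma polyEval_mem_tameRing (p : ℝ[X]) : (fun g => p.eval g) ∈ tameRing :=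
  ⟨p.continuous.continuousOn, letI := polyEval.toAlgebra; isAlgebraic_algebraMap p⟩

lemma id_mem_tameRing : (fun g => g) ∈ tameRing := by
  simpa using polyEval_mem_tameRing X

lemma const_mem_tameRing (c : ℝ) : (fun _ => c) ∈ tameRing := by
  simpa using polyEval_mem_tameRing (C c)

lemma inv_mem_tameRing {f : ℝ → ℝ} (hf : f ∈ tameRing) (h0 : ∀ g, 0 < g → f g ≠ 0) :
    f⁻¹ ∈ tameRing := by
  refine ⟨hf.1.inv₀ fun g hg => h0 g hg, ?_⟩
  let := polyEval.toAlgebra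
  let : Invertible (fun g : Ioi (0 : ℝ) => f g) :=
    ⟨fun g => (f g)⁻¹, funext fun g => inv_mul_cancel₀ (h0 g g.2),
      funext fun g => mul_inv_cancel₀ (h0 g g.2)⟩
  exact IsAlgebraic.invOf (R := ℝ[X]) hf.2

lemma mem_tameRing_of_root {f : ℝ → ℝ} (hc : ContinuousOn f (Ioi 0)) {Q : ℝ[X][X]} (hQ : Q ≠ 0)
    (h : ∀ g, 0 < g → (Q.map (evalRingHom g)).eval (f g) = 0) : f ∈ tameRing := by
  refine ⟨hc, Q, hQ, funext fun g => ?_⟩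
  let := polyEval.toAlgebra
  have h1 : (Pi.evalRingHom (fun _ : Ioi (0 : ℝ) => ℝ) g).comp polyEval = evalRingHom (g : ℝ) := rfl
  have h2 := hom_eval₂ Q polyEval (Pi.evalRingHom (fun _ : Ioi (0 : ℝ) => ℝ) g)
    (fun g : Ioi (0 : ℝ) => f g)
  rw [h1] at h2
  have h3 := h g g.2
  rw [eval_map] at h3
  exact h2.trans h3

lemma exists_root_of_mem_tameRing {f : ℝ → ℝ} (hf : f ∈ tameRing) :
    ∃ Q : ℝ[X][X], Q ≠ 0 ∧ ∀ g, 0 < g → (Q.map (evalRingHom g)).eval (f g) = 0 := by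
  obtain ⟨-, Q, hQ, h⟩ := hf
  refine ⟨Q, hQ, fun g hg => ?_⟩
  let := polyEval.toAlgebra
  have h1 : (Pi.evalRingHom (fun _ : Ioi (0 : ℝ) => ℝ) ⟨g, hg⟩).comp polyEval = evalRingHom g := rfl
  have h2 := hom_eval₂ Q polyEval (Pi.evalRingHom (fun _ : Ioi (0 : ℝ) => ℝ) ⟨g, hg⟩)
    (fun g : Ioi (0 : ℝ) => f g)
  rw [h1] at h2
  rw [eval_map]
  exact h2.symm.trans (congrFun h ⟨g, hg⟩)

lemma exists_forall_eval_ne_zero {q : ℝ[X]} (hq : q ≠ 0) :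
    ∃ η > 0, ∀ g ∈ Ioo (0 : ℝ) η, q.eval g ≠ 0 := by
  have hfin : (({x | q.IsRoot x} : Set ℝ) \ {0}).Finite := (finite_setOfPred_isRoot hq).subset sdiff_subset
  have hmem : (({x | q.IsRoot x} : Set ℝ) \ {0})ᶜ ∈ nhds (0 : ℝ) :=
    hfin.isClosed.isOpen_compl.mem_nhds (by simp)
  obtain ⟨η, hη, h⟩ := Metric.mem_nhds_iff.1 hmem
  refine ⟨η, hη, fun g hg h0 => h ?_ ⟨h0, hg.1.ne'⟩⟩
  rw [Metric.mem_ball, Real.dist_eq, sub_zero, abs_of_pos hg.1]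
  exact hg.2

/-- A continuous algebraic function has a constant sign near `0`. After division of its equation by
a power of the unknown, the constant coefficient does not vanish on some `(0, η)`; there the zero set
of the function is closed and so is its complement, which is the zero set of the divided equation. -/
lemma exists_sign_of_mem_tameRing {f : ℝ → ℝ} (hf : f ∈ tameRing) :
    ∃ η > 0, (∀ g ∈ Ioo 0 η, 0 ≤ f g) ∨ ∀ g ∈ Ioo 0 η, f g ≤ 0 := by
  obtain ⟨Q, hQ, h⟩ := exists_root_of_mem_tameRing hf
  obtain ⟨Q₁, hQQ, hQ₁⟩ := exists_eq_pow_rootMultiplicity_mul_and_not_dvd Q hQ 0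
  rw [C_0, sub_zero] at hQQ hQ₁
  rw [X_dvd_iff] at hQ₁
  obtain ⟨η, hη, hne⟩ := exists_forall_eval_ne_zero hQ₁
  refine ⟨η, hη, ?_⟩
  set f' : Ioo 0 η → ℝ := fun g => f g with hf'
  have hcf : Continuous f' := by
    have := hf.1.mono (fun g hg => hg.1 : Ioo 0 η ⊆ Ioi 0)
    exact continuousOn_iff_continuous_domRestrict.1 this
  set F : Ioo 0 η → ℝ := fun g => (Q₁.map (evalRingHom (g : ℝ))).eval (f' g) with hF
  have hcF : Continuous F := by
    have : F = fun g : Ioo 0 η =>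
        ∑ k ∈ Finset.range (Q₁.natDegree + 1), (Q₁.coeff k).eval (g : ℝ) * f' g ^ k := by
      ext g
      simp only [hF]
      rw [eval_map, eval₂_eq_sum_range]
      rfl
    rw [this]
    exact continuous_finsetSum _ fun k _ =>
      ((Q₁.coeff k).continuous.comp continuous_subtype_val).mul (hcf.pow k)
  have hiff : ∀ g, f' g ≠ 0 ↔ F g = 0 := fun g => by
    constructor
    · intro hg
      have h1 := h g g.2.1
      rw [hQQ, Polynomial.map_mul, eval_mul, Polynomial.map_pow, map_X, eval_pow, eval_X] at h1
      exact (mul_eq_zero.1 h1).resolve_left (pow_ne_zero _ hg)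
    · intro hg h0
      apply hne g g.2
      simp only [hF] at hg
      rwa [h0, ← coeff_zero_eq_eval_zero, coeff_map] at hg
  have : PreconnectedSpace (Ioo 0 η) := Subtype.preconnectedSpace isPreconnected_Ioo
  have hclopen : IsClopen {g | f' g = 0} := by
    refine ⟨isClosed_eq hcf continuous_const, ?_⟩
    have : {g | f' g = 0} = {g | F g = 0}ᶜ := by
      ext g; simp only [mem_ofPred_eq, mem_compl_iff, ← hiff, not_not]
    rw [this]
    exact (isClosed_eq hcF continuous_const).isOpen_compl
  rcases isClopen_iff.1 hclopen with h1 | h1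
  · have hne' : ∀ g, f' g ≠ 0 := fun g hg => by
      have : g ∈ {g | f' g = 0} := hg
      rw [h1] at this; exact this
    have hclopen2 : IsClopen {g | 0 < f' g} := by
      refine ⟨?_, isOpen_lt continuous_const hcf⟩
      have : {g | 0 < f' g} = {g | 0 ≤ f' g} := by
        ext g; simp only [mem_ofPred_eq]
        exact ⟨fun h => le_of_lt h, fun h => lt_of_le_of_ne h (hne' g).symm⟩
      rw [this]
      exact isClosed_le continuous_const hcf
    rcases isClopen_iff.1 hclopen2 with h2 | h2
    · right
      intro g hg
      by_contra hcon
      have : (⟨g, hg⟩ : Ioo 0 η) ∈ {g | 0 < f' g} := not_le.1 hcon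
      rw [h2] at this; exact this
    · left
      intro g hg
      have : (⟨g, hg⟩ : Ioo 0 η) ∈ {g | 0 < f' g} := by rw [h2]; trivial
      exact le_of_lt this
  · left
    intro g hg
    have : (⟨g, hg⟩ : Ioo 0 η) ∈ {g | f' g = 0} := by rw [h1]; trivial
    exact this.ge

/-- The ring of functions that, together with a derivative, are continuous and algebraic on
`(0, ∞)`. -/
noncomputable def smoothTameRing : Subring (ℝ → ℝ) where
  carrier := {f | f ∈ tameRing ∧ ∃ f' ∈ tameRing, ∀ g, 0 < g → HasDerivAt f (f' g) g}
  mul_mem' := by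
    rintro a b ⟨ha, a', ha', hda⟩ ⟨hb, b', hb', hdb⟩
    exact ⟨mul_mem ha hb, a' * b + a * b', add_mem (mul_mem ha' hb) (mul_mem ha hb'),
      fun g hg => (hda g hg).mul (hdb g hg)⟩
  add_mem' := by
    rintro a b ⟨ha, a', ha', hda⟩ ⟨hb, b', hb', hdb⟩
    exact ⟨add_mem ha hb, a' + b', add_mem ha' hb', fun g hg => (hda g hg).add (hdb g hg)⟩
  one_mem' := ⟨one_mem _, 0, zero_mem _, fun g _ => hasDerivAt_const g (1 : ℝ)⟩
  zero_mem' := ⟨zero_mem _, 0, zero_mem _, fun g _ => hasDerivAt_const g (0 : ℝ)⟩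
  neg_mem' := by
    rintro a ⟨ha, a', ha', hda⟩
    exact ⟨neg_mem ha, -a', neg_mem ha', fun g hg => (hda g hg).neg⟩

lemma id_mem_smoothTameRing : (fun g => g) ∈ smoothTameRing :=
  ⟨id_mem_tameRing, _, const_mem_tameRing 1, fun g _ => hasDerivAt_id g⟩

lemma const_mem_smoothTameRing (c : ℝ) : (fun _ => c) ∈ smoothTameRing :=
  ⟨const_mem_tameRing c, _, const_mem_tameRing 0, fun g _ => hasDerivAt_const g c⟩

lemma inv_mem_smoothTameRing {f : ℝ → ℝ} (hf : f ∈ smoothTameRing) (h0 : ∀ g, 0 < g → f g ≠ 0) :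
    f⁻¹ ∈ smoothTameRing := by
  obtain ⟨hf, f', hf', hd⟩ := hf
  have hi := inv_mem_tameRing hf h0
  refine ⟨hi, -(f' * f⁻¹ * f⁻¹), neg_mem (mul_mem (mul_mem hf' hi) hi), fun g hg => ?_⟩
  refine ((hd g hg).inv (h0 g hg)).congr_deriv ?_
  have := h0 g hg
  simp only [Pi.neg_apply, Pi.mul_apply, Pi.inv_apply]
  field_simp

/-- A bounded algebraic function has bounded variation on `(0, b]`, because it is monotone near
`0`. The variation is recorded as a bounded primitive of the modulus of the derivative. -/
lemma exists_bounded_primitive_abs_deriv {f f' : ℝ → ℝ} (hf' : f' ∈ tameRing)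
    (hd : ∀ g, 0 < g → HasDerivAt f (f' g) g) {b B : ℝ} (hb : 0 < b)
    (hB : ∀ g ∈ Ioc 0 b, |f g| ≤ B) :
    ∃ (V : ℝ → ℝ) (D : ℝ), (∀ g, 0 < g → HasDerivAt V |f' g| g) ∧ ∀ g ∈ Ioc 0 b, |V g| ≤ D := by
  have hcont : ContinuousOn (fun g => |f' g|) (Ioi 0) := hf'.1.abs
  set V : ℝ → ℝ := fun g => ∫ s in b..g, |f' s| with hV
  have hdV : ∀ g, 0 < g → HasDerivAt V |f' g| g := fun g hg => by
    have hsub : uIcc b g ⊆ Ioi 0 := fun s hs => (lt_min hb hg).trans_le hs.1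
    refine intervalIntegral.integral_hasDerivAt_right
      ((hcont.mono hsub).intervalIntegrable) ?_ (hcont.continuousAt (Ioi_mem_nhds hg))
    exact hcont.stronglyMeasurableAtFilter isOpen_Ioi g hg
  obtain ⟨η, hη, hsign⟩ := exists_sign_of_mem_tameRing hf'
  set c := min (η / 2) b with hc
  have hc0 : 0 < c := lt_min (by linarith) hb
  have hcη : c < η := (min_le_left _ _).trans_lt (by linarith)
  have hcb : c ≤ b := min_le_right _ _
  have hnear : ∀ g ∈ Ioo 0 η, |V g - V c| = |f g - f c| := by
    intro g hg
    have hcm : c ∈ Ioo 0 η := ⟨hc0, hcη⟩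
    rcases hsign with hs | hs
    · have : ∀ x ∈ Ioo 0 η, HasDerivAt (V - f) 0 x := fun x hx => by
        refine ((hdV x hx.1).sub (hd x hx.1)).congr_deriv ?_
        rw [abs_of_nonneg (hs x hx), sub_self]
      have h1 := (convex_Ioo 0 η).is_const_of_fderivWithin_eq_zero (𝕜 := ℝ) (f := V - f)
        (fun x hx => (this x hx).differentiableAt.differentiableWithinAt)
        (fun x hx => by
          rw [fderivWithin_of_isOpen isOpen_Ioo hx]
          ext; simp [(this x hx).deriv]) hg hcm
      simp only [Pi.sub_apply] at h1
      congr 1; linarith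
    · have : ∀ x ∈ Ioo 0 η, HasDerivAt (V + f) 0 x := fun x hx => by
        refine ((hdV x hx.1).add (hd x hx.1)).congr_deriv ?_
        rw [abs_of_nonpos (hs x hx), neg_add_cancel]
      have h1 := (convex_Ioo 0 η).is_const_of_fderivWithin_eq_zero (𝕜 := ℝ) (f := V + f)
        (fun x hx => (this x hx).differentiableAt.differentiableWithinAt)
        (fun x hx => by
          rw [fderivWithin_of_isOpen isOpen_Ioo hx]
          ext; simp [(this x hx).deriv]) hg hcm
      simp only [Pi.add_apply] at h1
      rw [← abs_neg]; congr 1; linarith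
  have hVc : ContinuousOn V (Icc c b) := fun g hg =>
    (hdV g (hc0.trans_le hg.1)).continuousAt.continuousWithinAt
  obtain ⟨D, hD⟩ := isCompact_Icc.exists_bound_of_continuousOn hVc
  refine ⟨V, D + 2 * B, hdV, fun g hg => ?_⟩
  have hB0 : 0 ≤ B := (abs_nonneg _).trans (hB g hg)
  rcases le_total c g with h | h
  · have := hD g ⟨h, hg.2⟩
    rw [Real.norm_eq_abs] at this
    linarith
  · have h1 := hnear g ⟨hg.1, h.trans_lt hcη⟩
    have h2 := hD c ⟨le_rfl, hcb⟩
    rw [Real.norm_eq_abs] at h2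
    have h3 := abs_sub (f g) (f c)
    have h4 := hB g hg
    have h5 := hB c ⟨hc0, hcb⟩
    have h6 := abs_sub_abs_le_abs_sub (V g) (V c)
    linarith

end Algebraic

section MatrixEntries

variable {ι : Type*}

/-- The entries of the matrix-valued function `M` lie in the ring `R` of functions. -/
def EntriesIn (R : Subring (ℝ → ℝ)) (M : ℝ → Matrix ι ι ℝ) : Prop :=
  ∀ x y, (fun g => M g x y) ∈ R

variable {R : Subring (ℝ → ℝ)} {M M' : ℝ → Matrix ι ι ℝ}

lemma EntriesIn.sub (h : EntriesIn R M) (h' : EntriesIn R M') :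
    EntriesIn R fun g => M g - M' g := fun x y => sub_mem (h x y) (h' x y)

lemma EntriesIn.add (h : EntriesIn R M) (h' : EntriesIn R M') :
    EntriesIn R fun g => M g + M' g := fun x y => add_mem (h x y) (h' x y)

lemma EntriesIn.smul {f : ℝ → ℝ} (hf : f ∈ R) (h : EntriesIn R M) :
    EntriesIn R fun g => f g • M g := fun x y => mul_mem hf (h x y)

lemma EntriesIn.const (hc : ∀ c : ℝ, (fun _ => c) ∈ R) (A : Matrix ι ι ℝ) :
    EntriesIn R fun _ => A := fun x y => hc (A x y)

variable [Fintype ι]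

lemma EntriesIn.mul (h : EntriesIn R M) (h' : EntriesIn R M') :
    EntriesIn R fun g => M g * M' g := fun x y => by
  have : (fun g => (M g * M' g) x y) = ∑ k, (fun g => M g x k) * fun g => M' g k y := by
    ext g; simp [Matrix.mul_apply]
  rw [this]
  exact sum_mem fun k _ => mul_mem (h x k) (h' k y)

variable [DecidableEq ι]

lemma EntriesIn.det (h : EntriesIn R M) : (fun g => (M g).det) ∈ R := by
  have : (fun g => (M g).det) = ∑ σ : Equiv.Perm ι, Equiv.Perm.sign σ • ∏ i, fun g => M g (σ i) i := by
    ext g; simp [Matrix.det_apply, Finset.sum_apply, Finset.prod_apply]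
  rw [this]
  exact sum_mem fun σ _ => zsmul_mem (prod_mem fun i _ => h _ _) _

/-- Cramer's rule. -/
lemma EntriesIn.inv (hinv : ∀ f ∈ R, (∀ g, 0 < g → f g ≠ 0) → f⁻¹ ∈ R) (h : EntriesIn R M)
    (h0 : ∀ g, 0 < g → (M g).det ≠ 0) : EntriesIn R fun g => (M g)⁻¹ := fun x y => by
  have : (fun g => (M g)⁻¹ x y) = (fun g => (M g).det)⁻¹ *
      fun g => ((M g).updateRow y (Pi.single x 1)).det := by
    ext g; simp [Matrix.inv_def, Ring.inverse_eq_inv', Matrix.adjugate_apply]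
  rw [this]
  refine mul_mem (hinv _ h.det h0) (EntriesIn.det fun a b => ?_)
  by_cases hay : a = y
  · subst hay
    simp only [Matrix.updateRow_self]
    by_cases hbx : b = x
    · subst hbx
      simp only [Pi.single_eq_same]
      exact one_mem R
    · simp only [Pi.single_eq_of_ne hbx]
      exact zero_mem R
  · simp only [Matrix.updateRow_ne hay]
    exact h a b

end MatrixEntries

/-! ### Spectral data of the transverse-field Hamiltonian as functions of the field -/

section EntryDeriv

variable {ι : Type*}

/-- Entrywise differentiability of a matrix-valued function. -/
def HasEntryDeriv (M : ℝ → Matrix ι ι ℝ) (M' : Matrix ι ι ℝ) (g : ℝ) : Prop :=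
  ∀ x y, HasDerivAt (fun s => M s x y) (M' x y) g

variable {M B : ℝ → Matrix ι ι ℝ} {M' B' : Matrix ι ι ℝ} {g : ℝ}

lemma HasEntryDeriv.mul [Fintype ι] (hM : HasEntryDeriv M M' g) (hB : HasEntryDeriv B B' g) :
    HasEntryDeriv (fun s => M s * B s) (M' * B g + M g * B') g := fun x y => by
  simp only [Matrix.mul_apply, Matrix.add_apply, ← Finset.sum_add_distrib]
  exact HasDerivAt.fun_sum fun k _ => (hM x k).mul (hB k y)

lemma HasEntryDeriv.smul {f : ℝ → ℝ} {f' : ℝ} (hf : HasDerivAt f f' g)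
    (hM : HasEntryDeriv M M' g) : HasEntryDeriv (fun s => f s • M s) (f' • M g + f g • M') g :=
  fun x y => hf.mul (hM x y)

lemma HasEntryDeriv.unique (h : HasEntryDeriv M M' g) (h' : HasEntryDeriv B B' g)
    (heq : ∀ᶠ s in nhds g, M s = B s) : M' = B' := by
  ext x y
  refine (h x y).unique ((h' x y).congr_of_eventuallyEq ?_)
  filter_upwards [heq] with s hs
  rw [hs]

lemma EntriesIn.exists_entryDeriv (h : EntriesIn smoothTameRing M) :
    ∃ D : ℝ → Matrix ι ι ℝ, EntriesIn tameRing D ∧ ∀ g, 0 < g → HasEntryDeriv M (D g) g := by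
  choose D hD hd using fun x y => (h x y).2
  exact ⟨fun g => Matrix.of fun x y => D x y g, fun x y => hD x y, fun g hg x y => hd x y g hg⟩

lemma abs_mul_apply_le [Fintype ι] {A C : Matrix ι ι ℝ} {a c : ℝ} (ha : ∀ x y, |A x y| ≤ a)
    (hc : ∀ x y, |C x y| ≤ c) (x y : ι) : |(A * C) x y| ≤ Fintype.card ι * (a * c) := by
  rw [Matrix.mul_apply]
  refine (Finset.abs_sum_le_sum_abs _ _).trans ?_
  calc ∑ k, |A x k * C k y| ≤ ∑ _k : ι, a * c := Finset.sum_le_sum fun k _ => by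
        rw [abs_mul]
        exact mul_le_mul (ha x k) (hc k y) (abs_nonneg _) ((abs_nonneg _).trans (ha x k))
    _ = _ := by simp

end EntryDeriv

section SpectralData

variable {N : ℕ} (E : SpinConfig N → ℝ) (g : ℝ)

/-- `H(g) - ε₀(g) + u uᵀ` with `u` the vector of ones. The overlap of `u` with the ground state is
not zero, so this matrix is invertible, while its entries are as regular as the ground energy. -/
noncomputable def borderedTfim : Matrix (SpinConfig N) (SpinConfig N) ℝ :=
  realTfim E g - groundEnergy E g • 1 + vecMulVec 1 1

/-- The ground vector with entries summing to `1`. -/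
noncomputable def groundVec : SpinConfig N → ℝ := (borderedTfim E g)⁻¹ *ᵥ 1

/-- The orthogonal projection onto the ground state. -/
noncomputable def groundProj : Matrix (SpinConfig N) (SpinConfig N) ℝ :=
  (groundVec E g ⬝ᵥ groundVec E g)⁻¹ • vecMulVec (groundVec E g) (groundVec E g)

/-- The reduced resolvent: the inverse of `H(g) - ε₀(g)` on the orthogonal complement of the ground
state, and zero on the ground state. -/
noncomputable def reducedResolvent : Matrix (SpinConfig N) (SpinConfig N) ℝ :=
  (1 - groundProj E g) * (borderedTfim E g)⁻¹ * (1 - groundProj E g)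

/-- The operator `g²ᴺ S² X P`, with `S` the reduced resolvent, `X = ∑ᵢ σᵢˣ` and `P` the ground state
projection. It controls the transitions out of the ground state along a schedule whose speed is
proportional to `g²ᴺ`. -/
noncomputable def transitionOp : Matrix (SpinConfig N) (SpinConfig N) ℝ :=
  g ^ (2 * N) • (reducedResolvent E g * reducedResolvent E g * hopping N * groundProj E g)

variable {E g}

lemma dotProduct_mulVec_symm {ι : Type*} [Fintype ι] {A : Matrix ι ι ℝ} (hA : A.IsHermitian)
    (v w : ι → ℝ) : v ⬝ᵥ A *ᵥ w = (A *ᵥ v) ⬝ᵥ w := by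
  rw [dotProduct_mulVec, ← mulVec_transpose, ← conjTranspose_eq_transpose_of_trivial, hA.eq]

lemma vecMulVec_one_mulVec {ι : Type*} [Fintype ι] (v : ι → ℝ) :
    vecMulVec (1 : ι → ℝ) 1 *ᵥ v = (∑ x, v x) • (1 : ι → ℝ) := by
  rw [vecMulVec_mulVec, one_dotProduct]; ext; simp

lemma borderedTfim_mulVec (v : SpinConfig N → ℝ) : borderedTfim E g *ᵥ v =
    realTfim E g *ᵥ v - groundEnergy E g • v + (∑ x, v x) • (1 : SpinConfig N → ℝ) := by
  rw [borderedTfim, add_mulVec, sub_smul_one_mulVec, vecMulVec_one_mulVec]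

lemma det_borderedTfim_ne_zero (hN : 1 ≤ N) (hg : 0 < g) : (borderedTfim E g).det ≠ 0 := by
  intro h0
  obtain ⟨v, hv, hKv⟩ := exists_mulVec_eq_zero_iff.2 h0
  obtain ⟨p, hp, hHp⟩ := exists_pos_groundVector E hg
  have hsum : 0 < ∑ x, p x := Finset.sum_pos (fun x _ => hp x) Finset.univ_nonempty
  rw [borderedTfim_mulVec] at hKv
  have h1 : p ⬝ᵥ (realTfim E g *ᵥ v - groundEnergy E g • v +
      (∑ x, v x) • (1 : SpinConfig N → ℝ)) = (∑ x, v x) * ∑ x, p x := by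
    rw [dotProduct_add, dotProduct_sub, dotProduct_mulVec_symm (realTfim_isHermitian E g), hHp,
      smul_dotProduct, dotProduct_smul, sub_self, zero_add, dotProduct_smul, dotProduct_one,
      smul_eq_mul]
  rw [hKv, dotProduct_zero] at h1
  have h2 : ∑ x, v x = 0 := by
    rcases mul_eq_zero.1 h1.symm with h | h
    · exact h
    · exact absurd h hsum.ne'
  rw [h2, zero_smul, add_zero, sub_eq_zero] at hKv
  obtain ⟨c, rfl⟩ := groundVector_unique hN hg hp hHp hKv
  simp only [Pi.smul_apply, smul_eq_mul, ← Finset.mul_sum] at h2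
  rcases mul_eq_zero.1 h2 with h | h
  · exact hv (by rw [h, zero_smul])
  · exact hsum.ne' h

lemma groundVec_spec (hN : 1 ≤ N) (hg : 0 < g) : (∀ x, 0 < groundVec E g x) ∧
    realTfim E g *ᵥ groundVec E g = groundEnergy E g • groundVec E g ∧
    ∑ x, groundVec E g x = 1 := by
  obtain ⟨p, hp, hHp⟩ := exists_pos_groundVector E hg
  have hsum : 0 < ∑ x, p x := Finset.sum_pos (fun x _ => hp x) Finset.univ_nonempty
  have hq : groundVec E g = (∑ x, p x)⁻¹ • p := by
    have h1 : borderedTfim E g *ᵥ ((∑ x, p x)⁻¹ • p) = 1 := by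
      rw [mulVec_smul, borderedTfim_mulVec, hHp, sub_self, zero_add, smul_smul,
        inv_mul_cancel₀ hsum.ne', one_smul]
    rw [groundVec, ← h1, mulVec_mulVec,
      nonsing_inv_mul _ (isUnit_iff_ne_zero.2 (det_borderedTfim_ne_zero hN hg)), one_mulVec]
  rw [hq]
  refine ⟨fun x => mul_pos (inv_pos.2 hsum) (hp x), ?_, ?_⟩
  · rw [mulVec_smul, hHp, smul_comm]
  · simp only [Pi.smul_apply, smul_eq_mul, ← Finset.mul_sum]
    exact inv_mul_cancel₀ hsum.ne'

lemma dotProduct_pos_of_pos {ι : Type*} [Fintype ι] [Nonempty ι] {v w : ι → ℝ}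
    (hv : ∀ x, 0 < v x) (hw : ∀ x, 0 < w x) : 0 < v ⬝ᵥ w :=
  Finset.sum_pos (fun x _ => mul_pos (hv x) (hw x)) Finset.univ_nonempty

lemma dotProduct_hopping_mulVec_le (v : SpinConfig N → ℝ) :
    |v ⬝ᵥ hopping N *ᵥ v| ≤ N * (v ⬝ᵥ v) := by
  have h1 : v ⬝ᵥ hopping N *ᵥ v = ∑ i, ∑ x, v x * v (spinFlip i x) := by
    simp only [dotProduct, hopping_mulVec, Finset.mul_sum]
    exact Finset.sum_comm
  rw [h1]
  refine (Finset.abs_sum_le_sum_abs _ _).trans ?_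
  have h2 : ∀ i : Fin N, |∑ x, v x * v (spinFlip i x)| ≤ v ⬝ᵥ v := fun i => by
    have hperm : ∑ x, v (spinFlip i x) * v (spinFlip i x) = ∑ x, v x * v x :=
      Function.Involutive.bijective (spinFlip_spinFlip i) |>.sum_comp fun x => v x * v x
    have h3 : v ⬝ᵥ v = ∑ x, (v x * v x + v (spinFlip i x) * v (spinFlip i x)) / 2 := by
      rw [← Finset.sum_div, Finset.sum_add_distrib, hperm]
      simp [dotProduct]
    rw [h3]
    refine (Finset.abs_sum_le_sum_abs _ _).trans (Finset.sum_le_sum fun x _ => ?_)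
    rw [abs_le]
    constructor <;> nlinarith [sq_nonneg (v x - v (spinFlip i x)),
      sq_nonneg (v x + v (spinFlip i x))]
  calc _ ≤ ∑ _i : Fin N, v ⬝ᵥ v := Finset.sum_le_sum fun i _ => h2 i
    _ = _ := by simp

lemma realTfim_mulVec_eq_add (E : SpinConfig N → ℝ) (g g' : ℝ) (v : SpinConfig N → ℝ) :
    realTfim E g' *ᵥ v = realTfim E g *ᵥ v - (g' - g) • hopping N *ᵥ v := by
  simp only [realTfim, sub_mulVec, smul_mulVec, sub_smul]
  abel

/-- The variational principle makes the ground energy Lipschitz. -/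
lemma groundEnergy_sub_le (hg : 0 < g) (g' : ℝ) :
    groundEnergy E g' - groundEnergy E g ≤ N * |g' - g| := by
  obtain ⟨p, hp, hHp⟩ := exists_pos_groundVector E hg
  have hpp := dotProduct_pos_of_pos hp hp
  have h := minEnergy_mul_le (realTfim_isHermitian E g') p
  rw [realTfim_mulVec_eq_add E g g', hHp, dotProduct_sub, dotProduct_smul, dotProduct_smul,
    smul_eq_mul, smul_eq_mul] at h
  have h2 : -((g' - g) * (p ⬝ᵥ hopping N *ᵥ p)) ≤ |g' - g| * (N * (p ⬝ᵥ p)) := by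
    refine (neg_le_abs _).trans ?_
    rw [abs_mul]
    exact mul_le_mul_of_nonneg_left (dotProduct_hopping_mulVec_le p) (abs_nonneg _)
  have h3 : (groundEnergy E g' - groundEnergy E g) * (p ⬝ᵥ p) ≤ (N * |g' - g|) * (p ⬝ᵥ p) := by
    have : groundEnergy E g' * (p ⬝ᵥ p) ≤ _ := h
    linarith
  exact le_of_mul_le_mul_right h3 hpp

open Polynomial in
lemma groundEnergy_mem_tameRing : groundEnergy E ∈ tameRing := by
  have hcont : ContinuousOn (groundEnergy E) (Set.Ioi 0) := by
    have : LipschitzOnWith N (groundEnergy E) (Set.Ioi 0) := by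
      refine LipschitzOnWith.of_dist_le_mul fun g hg g' hg' => ?_
      rw [Real.dist_eq, Real.dist_eq, abs_le]
      have h1 := groundEnergy_sub_le (E := E) hg g'
      have h2 := groundEnergy_sub_le (E := E) hg' g
      rw [abs_sub_comm] at h1
      push_cast
      constructor <;> linarith
    exact this.continuousOn
  set A : Matrix (SpinConfig N) (SpinConfig N) ℝ[X] :=
    (diagonal E).map C - (X : ℝ[X]) • (hopping N).map C with hA
  refine mem_tameRing_of_root hcont A.charpoly_monic.ne_zero fun g _ => ?_
  have hmap : A.map (evalRingHom g) = realTfim E g := by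
    ext x y
    by_cases h : x = y
    · subst h; simp [hA, realTfim]; ring
    · simp [hA, realTfim, h]; ring
  rw [← Matrix.charpoly_map, hmap]
  refine Matrix.mem_spectrum_iff_isRoot_charpoly.1 ?_
  rw [← energyLevels_map_eq_spectrum]
  exact minEnergy_mem (realTfim_isHermitian E g)

section Regularity

variable {R : Subring (ℝ → ℝ)}

lemma entriesIn_realTfim (hid : (fun g => g) ∈ R) (hc : ∀ c : ℝ, (fun _ => c) ∈ R) :
    EntriesIn R (realTfim E) :=
  (EntriesIn.const hc _).sub (EntriesIn.smul hid (EntriesIn.const hc _))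

lemma entriesIn_borderedTfim_inv (hN : 1 ≤ N) (hid : (fun g => g) ∈ R)
    (hc : ∀ c : ℝ, (fun _ => c) ∈ R) (hinv : ∀ f ∈ R, (∀ g, 0 < g → f g ≠ 0) → f⁻¹ ∈ R)
    (hε : groundEnergy E ∈ R) : EntriesIn R fun g => (borderedTfim E g)⁻¹ :=
  EntriesIn.inv hinv (((entriesIn_realTfim hid hc).sub (EntriesIn.smul hε (EntriesIn.const hc _))).add
    (EntriesIn.const hc _)) fun _ hg => det_borderedTfim_ne_zero hN hg

lemma groundVec_mem (h : EntriesIn R fun g => (borderedTfim E g)⁻¹) (x : SpinConfig N) :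
    (fun g => groundVec E g x) ∈ R := by
  have : (fun g => groundVec E g x) = ∑ y, fun g => (borderedTfim E g)⁻¹ x y := by
    ext g; simp [groundVec, mulVec, dotProduct]
  rw [this]
  exact sum_mem fun y _ => h x y

lemma groundVec_dotProduct_mem (h : EntriesIn R fun g => (borderedTfim E g)⁻¹) :
    (fun g => groundVec E g ⬝ᵥ groundVec E g) ∈ R := by
  have : (fun g => groundVec E g ⬝ᵥ groundVec E g) =
      ∑ x, (fun g => groundVec E g x) * fun g => groundVec E g x := by
    ext g; simp [dotProduct]
  rw [this]
  exact sum_mem fun x _ => mul_mem (groundVec_mem h x) (groundVec_mem h x)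

lemma entriesIn_groundProj (hN : 1 ≤ N) (hinv : ∀ f ∈ R, (∀ g, 0 < g → f g ≠ 0) → f⁻¹ ∈ R)
    (h : EntriesIn R fun g => (borderedTfim E g)⁻¹) : EntriesIn R (groundProj E) :=
  EntriesIn.smul (hinv _ (groundVec_dotProduct_mem h) fun _ hg =>
    (dotProduct_pos_of_pos (groundVec_spec hN hg).1 (groundVec_spec hN hg).1).ne')
    fun x y => mul_mem (groundVec_mem h x) (groundVec_mem h y)

end Regularity

/-- The Hellmann–Feynman formula, from the identity
`(ε(g') - ε(g)) q(g)·q(g') = -(g' - g) q(g)·X q(g')`. -/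
lemma hasDerivAt_groundEnergy (hN : 1 ≤ N) (hg : 0 < g) :
    HasDerivAt (groundEnergy E) (-((groundVec E g ⬝ᵥ groundVec E g)⁻¹ *
      (groundVec E g ⬝ᵥ hopping N *ᵥ groundVec E g))) g := by
  have hK := entriesIn_borderedTfim_inv hN id_mem_tameRing const_mem_tameRing
    (fun f hf h0 => inv_mem_tameRing hf h0) (groundEnergy_mem_tameRing (E := E))
  have hq : ContinuousAt (groundVec E) g := continuousAt_pi.2 fun x =>
    (groundVec_mem hK x).1.continuousAt (Ioi_mem_nhds hg)
  have hqq := dotProduct_pos_of_pos (groundVec_spec (E := E) hN hg).1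
    (groundVec_spec (E := E) hN hg).1
  have hlin : ∀ A : Matrix (SpinConfig N) (SpinConfig N) ℝ, ContinuousAt
      (fun s => groundVec E g ⬝ᵥ A *ᵥ groundVec E s) g := fun A => by
    have : Continuous fun v : SpinConfig N → ℝ => groundVec E g ⬝ᵥ A *ᵥ v := by fun_prop
    exact this.continuousAt.comp hq
  have hone := hlin 1
  simp only [one_mulVec] at hone
  have hcomb : ContinuousAt (fun s => -((groundVec E g ⬝ᵥ groundVec E s)⁻¹ *
      (groundVec E g ⬝ᵥ hopping N *ᵥ groundVec E s))) g :=
    ((hone.inv₀ hqq.ne').mul (hlin (hopping N))).neg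
  rw [hasDerivAt_iff_tendsto_slope]
  refine (hcomb.tendsto.mono_left nhdsWithin_le_nhds).congr' ?_
  filter_upwards [self_mem_nhdsWithin, mem_nhdsWithin_of_mem_nhds (Ioi_mem_nhds hg)] with s hs hs0
  have hs0 : 0 < s := hs0
  have hqs := dotProduct_pos_of_pos (groundVec_spec (E := E) hN hg).1
    (groundVec_spec (E := E) hN hs0).1
  have h1 := congrArg (groundVec E g ⬝ᵥ ·) (groundVec_spec (E := E) hN hs0).2.1
  simp only [realTfim_mulVec_eq_add E g s, dotProduct_sub, dotProduct_smul, smul_eq_mul,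
    dotProduct_mulVec_symm (realTfim_isHermitian E g), (groundVec_spec (E := E) hN hg).2.1,
    smul_dotProduct] at h1
  rw [slope_def_field, eq_div_iff (sub_ne_zero.2 hs), ← mul_left_inj' hqs.ne']
  have h2 := mul_inv_cancel₀ hqs.ne'
  linear_combination h1 - (s - g) * (groundVec E g ⬝ᵥ hopping N *ᵥ groundVec E s) * h2

lemma groundEnergy_mem_smoothTameRing (hN : 1 ≤ N) : groundEnergy E ∈ smoothTameRing := by
  have hK := entriesIn_borderedTfim_inv hN id_mem_tameRing const_mem_tameRing
    (fun f hf h0 => inv_mem_tameRing hf h0) (groundEnergy_mem_tameRing (E := E))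
  refine ⟨groundEnergy_mem_tameRing, _, ?_, fun g hg => hasDerivAt_groundEnergy hN hg⟩
  refine neg_mem (s := tameRing) (mul_mem (inv_mem_tameRing (groundVec_dotProduct_mem hK)
    fun g hg => (dotProduct_pos_of_pos (groundVec_spec hN hg).1 (groundVec_spec hN hg).1).ne') ?_)
  have : (fun g => groundVec E g ⬝ᵥ hopping N *ᵥ groundVec E g) =
      ∑ x, (fun g => groundVec E g x) * ∑ i, fun g => groundVec E g (spinFlip i x) := by
    ext g; simp [dotProduct, hopping_mulVec]
  rw [this]
  exact sum_mem fun x _ => mul_mem (groundVec_mem hK x) (sum_mem fun i _ => groundVec_mem hK _)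

lemma entriesIn_smooth (hN : 1 ≤ N) : EntriesIn smoothTameRing (groundProj E) ∧
    EntriesIn smoothTameRing (transitionOp E) := by
  have hinv := fun f (hf : f ∈ smoothTameRing) h0 => inv_mem_smoothTameRing hf h0
  have hK := entriesIn_borderedTfim_inv hN id_mem_smoothTameRing const_mem_smoothTameRing hinv
    (groundEnergy_mem_smoothTameRing (E := E) hN)
  have hP := entriesIn_groundProj hN hinv hK
  have h1P := (EntriesIn.const const_mem_smoothTameRing 1).sub hP
  have hS := (h1P.mul hK).mul h1P
  refine ⟨hP, EntriesIn.smul (pow_mem id_mem_smoothTameRing (2 * N))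
    (((hS.mul hS).mul (EntriesIn.const const_mem_smoothTameRing _)).mul hP)⟩

end SpectralData

/-! ### The ground state projection, the reduced resolvent and the transition operator -/

section Projection

variable {N : ℕ} {E : SpinConfig N → ℝ} {g : ℝ}

lemma groundVec_dotProduct_pos (hN : 1 ≤ N) (hg : 0 < g) :
    0 < groundVec E g ⬝ᵥ groundVec E g :=
  dotProduct_pos_of_pos (groundVec_spec hN hg).1 (groundVec_spec hN hg).1

lemma groundProj_mul_self (hN : 1 ≤ N) (hg : 0 < g) :
    groundProj E g * groundProj E g = groundProj E g := by
  rw [groundProj, smul_mul_smul_comm, vecMulVec_mul_vecMulVec, vecMulVec_smul, smul_smul]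
  congr 1
  have := (groundVec_dotProduct_pos (E := E) hN hg).ne'
  field_simp

lemma groundProj_transpose : (groundProj E g)ᵀ = groundProj E g := by
  rw [groundProj, transpose_smul, transpose_vecMulVec]

lemma groundProj_mulVec (v : SpinConfig N → ℝ) : groundProj E g *ᵥ v =
    ((groundVec E g ⬝ᵥ groundVec E g)⁻¹ * (groundVec E g ⬝ᵥ v)) • groundVec E g := by
  rw [groundProj, smul_mulVec, vecMulVec_mulVec, op_smul_eq_smul, smul_smul]

lemma groundProj_mulVec_of_ground (hN : 1 ≤ N) (hg : 0 < g) {v : SpinConfig N → ℝ}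
    (hv : realTfim E g *ᵥ v = groundEnergy E g • v) : groundProj E g *ᵥ v = v := by
  obtain ⟨hp, hHp, -⟩ := groundVec_spec (E := E) hN hg
  obtain ⟨c, rfl⟩ := groundVector_unique hN hg hp hHp hv
  rw [groundProj_mulVec, dotProduct_smul, smul_eq_mul, mul_left_comm,
    inv_mul_cancel₀ (groundVec_dotProduct_pos hN hg).ne', mul_one]

lemma realTfim_mul_groundProj (hN : 1 ≤ N) (hg : 0 < g) :
    realTfim E g * groundProj E g = groundEnergy E g • groundProj E g := by
  rw [groundProj, mul_smul_comm, mul_vecMulVec, (groundVec_spec hN hg).2.1, smul_vecMulVec,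
    smul_comm]

lemma realTfim_transpose : (realTfim E g)ᵀ = realTfim E g := by
  rw [← conjTranspose_eq_transpose_of_trivial, (realTfim_isHermitian E g).eq]

lemma groundProj_mul_realTfim (hN : 1 ≤ N) (hg : 0 < g) :
    groundProj E g * realTfim E g = groundEnergy E g • groundProj E g := by
  have := congrArg Matrix.transpose (realTfim_mul_groundProj (E := E) hN hg)
  rwa [transpose_mul, transpose_smul, groundProj_transpose, realTfim_transpose] at this

lemma borderedTfim_transpose : (borderedTfim E g)ᵀ = borderedTfim E g := by
  rw [borderedTfim, transpose_add, transpose_sub, transpose_smul, transpose_one,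
    transpose_vecMulVec, realTfim_transpose]

lemma reducedResolvent_transpose : (reducedResolvent E g)ᵀ = reducedResolvent E g := by
  rw [reducedResolvent, transpose_mul, transpose_mul, transpose_sub, transpose_one,
    groundProj_transpose, transpose_nonsing_inv, borderedTfim_transpose, mul_assoc]

lemma groundProj_mul_reducedResolvent (hN : 1 ≤ N) (hg : 0 < g) :
    groundProj E g * reducedResolvent E g = 0 := by
  have h : groundProj E g * (1 - groundProj E g) = 0 := by
    rw [mul_sub, mul_one, groundProj_mul_self hN hg, sub_self]
  rw [reducedResolvent, ← mul_assoc, ← mul_assoc, h, zero_mul, zero_mul]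

lemma reducedResolvent_mul_groundProj (hN : 1 ≤ N) (hg : 0 < g) :
    reducedResolvent E g * groundProj E g = 0 := by
  have h : (1 - groundProj E g) * groundProj E g = 0 := by
    rw [sub_mul, one_mul, groundProj_mul_self hN hg, sub_self]
  rw [reducedResolvent, mul_assoc, h, mul_zero]

lemma sub_mul_reducedResolvent (hN : 1 ≤ N) (hg : 0 < g) :
    (realTfim E g - groundEnergy E g • 1) * reducedResolvent E g = 1 - groundProj E g := by
  have hK : IsUnit (borderedTfim E g).det := isUnit_iff_ne_zero.2 (det_borderedTfim_ne_zero hN hg)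
  have h1 : (realTfim E g - groundEnergy E g • 1) * (1 - groundProj E g) =
      realTfim E g - groundEnergy E g • 1 := by
    rw [mul_sub, mul_one, sub_mul, realTfim_mul_groundProj hN hg, smul_mul_assoc, one_mul,
      sub_self, sub_zero]
  have h2 : (1 : SpinConfig N → ℝ) ᵥ* (borderedTfim E g)⁻¹ = groundVec E g := by
    rw [groundVec, ← vecMul_transpose, transpose_nonsing_inv, borderedTfim_transpose]
  have h3 : (realTfim E g - groundEnergy E g • 1) * (borderedTfim E g)⁻¹ =
      1 - vecMulVec 1 (groundVec E g) := by
    have : realTfim E g - groundEnergy E g • 1 = borderedTfim E g - vecMulVec 1 1 := by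
      rw [borderedTfim, add_sub_cancel_right]
    rw [this, sub_mul, mul_nonsing_inv _ hK, vecMulVec_mul, h2]
  have h4 : groundVec E g ᵥ* groundProj E g = groundVec E g := by
    rw [← mulVec_transpose, groundProj_transpose,
      groundProj_mulVec_of_ground hN hg (groundVec_spec hN hg).2.1]
  rw [reducedResolvent, ← mul_assoc, ← mul_assoc, h1, h3, sub_mul, one_mul, vecMulVec_mul,
    vecMul_sub, vecMul_one, h4, sub_self, vecMulVec_zero, sub_zero]

lemma reducedResolvent_mul_sub (hN : 1 ≤ N) (hg : 0 < g) :
    reducedResolvent E g * (realTfim E g - groundEnergy E g • 1) = 1 - groundProj E g := by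
  have := congrArg Matrix.transpose (sub_mul_reducedResolvent (E := E) hN hg)
  rwa [transpose_mul, transpose_sub, transpose_sub, transpose_smul, transpose_one,
    groundProj_transpose, realTfim_transpose, reducedResolvent_transpose] at this

/-- A spectral gap `Δ` bounds the entries of the reduced resolvent by `1 / Δ`. -/
lemma abs_reducedResolvent_le (hN : 1 ≤ N) (hg : 0 < g) {Δ : ℝ} (hΔ : 0 < Δ)
    (hgap : ∀ e ∈ energyLevels ((realTfim E g).map Complex.ofRealHom), e ≠ groundEnergy E g →
      Δ ≤ e - groundEnergy E g) (x y : SpinConfig N) : |reducedResolvent E g x y| ≤ 1 / Δ := by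
  have heig : ∀ (μ : ℝ) (f : SpinConfig N → ℝ), f ≠ 0 → reducedResolvent E g *ᵥ f = μ • f →
      0 ≤ μ ∧ μ ≤ 1 / Δ := by
    intro μ f hf h
    by_cases hμ : μ = 0
    · rw [hμ]; exact ⟨le_rfl, by positivity⟩
    · have hPf : groundProj E g *ᵥ f = 0 := by
        have h1 := congrArg (groundProj E g *ᵥ ·) h
        simp only [mulVec_mulVec, groundProj_mul_reducedResolvent hN hg, zero_mulVec,
          mulVec_smul] at h1
        exact (smul_eq_zero.1 h1.symm).resolve_left hμ
      have h2 := congrArg ((realTfim E g - groundEnergy E g • 1) *ᵥ ·) h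
      simp only [mulVec_mulVec, sub_mul_reducedResolvent hN hg, sub_mulVec, one_mulVec, hPf,
        sub_zero, mulVec_smul, smul_mulVec] at h2
      have h3 : realTfim E g *ᵥ f = (groundEnergy E g + 1 / μ) • f := by
        have h4 : (1 / μ) • f = realTfim E g *ᵥ f - groundEnergy E g • f := by
          nth_rw 1 [h2]
          rw [smul_smul, one_div_mul_cancel hμ, one_smul]
        rw [add_smul, h4]; abel
      have h5 := hgap _ ((mem_energyLevels_map_iff _ _).2 ⟨f, hf, h3⟩) (by
        have : 1 / μ ≠ 0 := one_div_ne_zero hμ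
        intro h6; apply this; linarith)
      rw [add_sub_cancel_left] at h5
      have h6 : 0 < μ := one_div_pos.1 (hΔ.trans_le h5)
      exact ⟨h6.le, (le_one_div hΔ h6).1 h5⟩
  have hherm : (reducedResolvent E g).IsHermitian := by
    rw [Matrix.IsHermitian, conjTranspose_eq_transpose_of_trivial, reducedResolvent_transpose]
  have hpos := posSemidef_of_forall_eigenvalue_nonneg hherm fun μ f hf h => (heig μ f hf h).1
  have hpos2 : ((1 / Δ) • (1 : Matrix _ _ ℝ) - reducedResolvent E g).PosSemidef := by
    refine posSemidef_of_forall_eigenvalue_nonneg (IsHermitian.sub ?_ hherm) fun μ f hf h => ?_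
    · rw [Matrix.IsHermitian, conjTranspose_eq_transpose_of_trivial, transpose_smul, transpose_one]
    · rw [sub_mulVec, smul_mulVec, one_mulVec] at h
      have := (heig (1 / Δ - μ) f hf (by rw [sub_smul, ← h]; abel)).2
      linarith
  refine abs_apply_le_of_posSemidef hpos (fun z => ?_) x y
  have := hpos2.diag_nonneg (i := z)
  simp only [Matrix.sub_apply, Matrix.smul_apply, one_apply_eq, smul_eq_mul, mul_one] at this
  linarith

lemma abs_groundProj_le (hN : 1 ≤ N) (hg : 0 < g) (x y : SpinConfig N) :
    |groundProj E g x y| ≤ 1 := by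
  have hs : ∀ z, groundProj E g x z = groundProj E g z x := fun z => by
    conv_lhs => rw [← groundProj_transpose]
    rfl
  have h1 : ∑ z, groundProj E g x z ^ 2 = groundProj E g x x := by
    conv_rhs => rw [← groundProj_mul_self hN hg, Matrix.mul_apply]
    exact Finset.sum_congr rfl fun z _ => by rw [← hs z, sq]
  have h2 : ∀ z, groundProj E g x z ^ 2 ≤ groundProj E g x x := fun z => by
    rw [← h1]
    exact Finset.single_le_sum (f := fun z => groundProj E g x z ^ 2) (fun _ _ => sq_nonneg _)
      (Finset.mem_univ z)
  have h3 : groundProj E g x x ≤ 1 := by nlinarith [h2 x]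
  exact (sq_le_one_iff_abs_le_one _).1 ((h2 y).trans h3)

lemma abs_hopping_le (x y : SpinConfig N) : |hopping N x y| ≤ N := by
  rw [abs_of_nonneg (hopping_nonneg x y), hopping, of_apply]
  calc _ ≤ ∑ _i : Fin N, (1 : ℝ) := Finset.sum_le_sum fun i _ => by split_ifs <;> norm_num
    _ = N := by simp

/-- The two poles of the resolvents, of order `N` each, are cancelled by `g²ᴺ`. -/
lemma exists_abs_transitionOp_le (hN : 1 ≤ N) {Γ₀ A : ℝ} (hA : 0 < A)
    (hgap : ∀ g, 0 < g → g ≤ Γ₀ → ∀ e ∈ energyLevels ((realTfim E g).map Complex.ofRealHom),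
      e ≠ groundEnergy E g → A * g ^ N ≤ e - groundEnergy E g) :
    ∃ B, ∀ g, 0 < g → g ≤ Γ₀ → ∀ x y, |transitionOp E g x y| ≤ B := by
  set c : ℝ := (Fintype.card (SpinConfig N) : ℝ)
  refine ⟨c * (c * (c * (1 / A ^ 2) * N) * 1), fun g hg hgΓ x y => ?_⟩
  have hΔ : 0 < A * g ^ N := by positivity
  have hS := abs_reducedResolvent_le hN hg hΔ (hgap g hg hgΓ)
  have h := abs_mul_apply_le (abs_mul_apply_le (abs_mul_apply_le hS hS) abs_hopping_le)
    (abs_groundProj_le (E := E) hN hg) x y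
  rw [transitionOp, Matrix.smul_apply, smul_eq_mul, abs_mul, abs_of_pos (pow_pos hg _)]
  refine (mul_le_mul_of_nonneg_left h (pow_pos hg _).le).trans_eq ?_
  simp only [c]
  field_simp
  ring

lemma sub_mul_transitionOp (hN : 1 ≤ N) (hg : 0 < g) :
    (realTfim E g - groundEnergy E g • 1) * transitionOp E g =
      g ^ (2 * N) • (reducedResolvent E g * hopping N * groundProj E g) := by
  rw [transitionOp, mul_smul_comm, ← mul_assoc, ← mul_assoc, ← mul_assoc,
    sub_mul_reducedResolvent hN hg, sub_mul, one_mul, groundProj_mul_reducedResolvent hN hg,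
    sub_zero]

lemma groundProj_mul_transitionOp (hN : 1 ≤ N) (hg : 0 < g) :
    groundProj E g * transitionOp E g = 0 := by
  rw [transitionOp, mul_smul_comm, ← mul_assoc, ← mul_assoc, ← mul_assoc,
    groundProj_mul_reducedResolvent hN hg]
  simp

lemma transitionOp_mul_groundProj (hN : 1 ≤ N) (hg : 0 < g) :
    transitionOp E g * groundProj E g = transitionOp E g := by
  rw [transitionOp, smul_mul_assoc, mul_assoc _ (groundProj E g), groundProj_mul_self hN hg]

/-- Differentiating `P² = P`. -/
lemma entryDeriv_groundProj_eq (hN : 1 ≤ N) (hg : 0 < g)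
    {P' : Matrix (SpinConfig N) (SpinConfig N) ℝ} (hP : HasEntryDeriv (groundProj E) P' g) :
    P' = P' * groundProj E g + groundProj E g * P' :=
  hP.unique (hP.mul hP) (by
    filter_upwards [Ioi_mem_nhds hg] with s hs
    exact (groundProj_mul_self hN hs).symm)

/-- First-order perturbation theory: the derivative of the ground state projection maps the ground
state to `S X` of it, by differentiation of `H P = ε P`. -/
lemma entryDeriv_mul_groundProj (hN : 1 ≤ N) (hg : 0 < g)
    {P' : Matrix (SpinConfig N) (SpinConfig N) ℝ} (hP : HasEntryDeriv (groundProj E) P' g) :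
    P' * groundProj E g = reducedResolvent E g * hopping N * groundProj E g := by
  have hH : HasEntryDeriv (realTfim E) (-hopping N) g := fun x y => by
    simp only [realTfim, Matrix.sub_apply, Matrix.smul_apply, smul_eq_mul, Matrix.neg_apply]
    simpa using ((hasDerivAt_id g).mul_const (hopping N x y)).const_sub (diagonal E x y)
  have h1 := (hH.mul hP).unique (HasEntryDeriv.smul (hasDerivAt_groundEnergy hN hg) hP) (by
    filter_upwards [Ioi_mem_nhds hg] with s hs
    exact realTfim_mul_groundProj hN hs)
  set ε' := -((groundVec E g ⬝ᵥ groundVec E g)⁻¹ * (groundVec E g ⬝ᵥ hopping N *ᵥ groundVec E g))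
  have h2 : (realTfim E g - groundEnergy E g • 1) * P' =
      ε' • groundProj E g + hopping N * groundProj E g := by
    rw [sub_mul, smul_mul_assoc, one_mul, sub_eq_iff_eq_add, add_right_comm, ← h1]
    rw [neg_mul]; abel
  have h3 := congrArg (reducedResolvent E g * ·) h2
  simp only [← mul_assoc, reducedResolvent_mul_sub hN hg, mul_add, mul_smul_comm,
    reducedResolvent_mul_groundProj hN hg, smul_zero, zero_add] at h3
  rw [← h3, sub_mul, one_mul]
  nth_rw 2 [entryDeriv_groundProj_eq hN hg hP]
  rw [add_sub_cancel_right]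

/-- The transition operator has bounded variation on `(0, Γ₀]`: the total variation of its entries
is recorded by the function `V`. -/
lemma exists_transitionOp_variation (hN : 1 ≤ N) {Γ₀ A : ℝ} (hΓ₀ : 0 < Γ₀) (hA : 0 < A)
    (hgap : ∀ g, 0 < g → g ≤ Γ₀ → ∀ e ∈ energyLevels ((realTfim E g).map Complex.ofRealHom),
      e ≠ groundEnergy E g → A * g ^ N ≤ e - groundEnergy E g) :
    ∃ (G' : ℝ → Matrix (SpinConfig N) (SpinConfig N) ℝ) (V : ℝ → ℝ) (D : ℝ),
      (∀ g, 0 < g → HasEntryDeriv (transitionOp E) (G' g) g) ∧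
      (∀ g, 0 < g → HasDerivAt V (∑ x, ∑ y, |G' g x y|) g) ∧
      (∀ g, 0 < g → g ≤ Γ₀ → |V g| ≤ D) ∧
      ∀ g, 0 < g → g ≤ Γ₀ → ∑ x, ∑ y, |transitionOp E g x y| ≤ D := by
  obtain ⟨B, hB⟩ := exists_abs_transitionOp_le hN hA hgap
  obtain ⟨G', hG', hdG⟩ := (entriesIn_smooth (E := E) hN).2.exists_entryDeriv
  choose V D hV hD using fun x y => exists_bounded_primitive_abs_deriv (hG' x y)
    (fun g hg => hdG g hg x y) hΓ₀ (fun g hg => hB g hg.1 hg.2 x y)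
  refine ⟨G', fun g => ∑ x, ∑ y, V x y g, max (∑ x, ∑ y, D x y)
    (∑ _x : SpinConfig N, ∑ _y : SpinConfig N, B), hdG,
    fun g hg => HasDerivAt.fun_sum fun x _ => HasDerivAt.fun_sum fun y _ => hV x y g hg,
    fun g hg hgΓ => ?_, fun g hg hgΓ => ?_⟩
  · refine le_trans ?_ (le_max_left _ _)
    exact (Finset.abs_sum_le_sum_abs _ _).trans (Finset.sum_le_sum fun x _ =>
      (Finset.abs_sum_le_sum_abs _ _).trans (Finset.sum_le_sum fun y _ => hD x y g ⟨hg, hgΓ⟩))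
  · refine le_trans ?_ (le_max_right _ _)
    exact Finset.sum_le_sum fun x _ => Finset.sum_le_sum fun y _ => hB g hg hgΓ x y

end Projection

/-! ### The adiabatic estimate -/

section Adiabatic

variable {V : Type*} [NormedAddCommGroup V] [InnerProductSpace ℂ V]

lemma hasDerivAt_norm_sq {z : ℝ → V} {z' : V} {t : ℝ} (h : HasDerivAt z z' t) :
    HasDerivAt (fun s => ‖z s‖ ^ 2) (2 * (inner ℂ (z t) z').re) t := by
  have h1 := Complex.reCLM.hasFDerivAt.comp_hasDerivAt t (h.inner ℂ h)
  have h2 : (fun s => ‖z s‖ ^ 2) = Complex.reCLM ∘ fun s => inner ℂ (z s) (z s) := by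
    ext s
    simpa using (inner_self_eq_norm_sq (𝕜 := ℂ) (z s)).symm
  rw [h2]
  refine h1.congr_deriv ?_
  have h3 : (inner ℂ z' (z t)).re = (inner ℂ (z t) z').re := by
    simpa using inner_re_symm (𝕜 := ℂ) z' (z t)
  simp only [map_add, Complex.reCLM_apply, h3]
  ring

/-- If `Re ⟨z, z'⟩ ≤ ‖z‖ b` then the norm of `z` grows at most at the rate `b`. The norm is
regularized because it need not be differentiable at zeros of `z`. -/
lemma norm_add_le_of_re_inner_le {z z' : ℝ → V} {U b : ℝ → ℝ} {t₀ : ℝ}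
    (hz : ContinuousOn z (Set.Ici t₀)) (hU : ContinuousOn U (Set.Ici t₀))
    (hz' : ∀ t, t₀ < t → HasDerivAt z (z' t) t) (hU' : ∀ t, t₀ < t → HasDerivAt U (-b t) t)
    (hb : ∀ t, t₀ < t → 0 ≤ b t) (h : ∀ t, t₀ < t → (inner ℂ (z t) (z' t)).re ≤ ‖z t‖ * b t)
    {t : ℝ} (ht : t₀ ≤ t) : ‖z t‖ + U t ≤ ‖z t₀‖ + U t₀ := by
  refine le_of_forall_pos_le_add fun η hη => ?_
  set n : ℝ → ℝ := fun s => √(η ^ 2 + ‖z s‖ ^ 2) with hn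
  have hpos : ∀ s, 0 < η ^ 2 + ‖z s‖ ^ 2 := fun s => by positivity
  have hd : ∀ s, t₀ < s → HasDerivAt (fun s => n s + U s)
      (2 * (inner ℂ (z s) (z' s)).re / (2 * n s) + -b s) s := fun s hs =>
    (((hasDerivAt_norm_sq (hz' s hs)).const_add (η ^ 2)).sqrt (hpos s).ne').add (hU' s hs)
  have hanti : AntitoneOn (fun s => n s + U s) (Set.Ici t₀) := by
    refine antitoneOn_of_deriv_nonpos (convex_Ici t₀)
      (((continuousOn_const.add (hz.norm.pow 2)).sqrt).add hU) ?_ ?_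
    · rw [interior_Ici]
      exact fun s hs => (hd s hs).differentiableAt.differentiableWithinAt
    · rw [interior_Ici]
      intro s hs
      rw [(hd s hs).deriv]
      have hns : 0 < n s := Real.sqrt_pos.2 (hpos s)
      have hle : ‖z s‖ ≤ n s := Real.le_sqrt_of_sq_le (by nlinarith)
      have h1 : 2 * (inner ℂ (z s) (z' s)).re / (2 * n s) ≤ b s := by
        rw [div_le_iff₀ (by positivity)]
        nlinarith [h s hs, mul_le_mul_of_nonneg_right hle (hb s hs)]
      linarith
  have h1 := hanti Set.self_mem_Ici ht ht
  have h2 : ‖z t‖ ≤ n t := Real.le_sqrt_of_sq_le (by nlinarith)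
  have h3 : n t₀ ≤ η + ‖z t₀‖ := Real.sqrt_le_iff.2
    ⟨by positivity, by nlinarith [norm_nonneg (z t₀)]⟩
  simp only at h1
  linarith

lemma re_inner_neg_I_smul {H : V →L[ℂ] V} (hH : ∀ v w, inner ℂ (H v) w = inner ℂ v (H w)) (v : V) :
    (inner ℂ v (-(Complex.I • H v))).re = 0 := by
  have h1 : (inner ℂ v (H v)).im = 0 := by
    have h2 := inner_conj_symm (𝕜 := ℂ) v (H v)
    rw [hH] at h2
    have := congrArg Complex.im h2
    rw [Complex.conj_im] at this
    linarith
  rw [inner_neg_right, inner_smul_right]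
  simp [h1]

/-- The Schrödinger evolution does not increase the norm. -/
lemma norm_le_of_schrodinger {H : ℝ → V →L[ℂ] V} {ψ ψ' : ℝ → V} {t₀ : ℝ}
    (hH : ∀ t, t₀ < t → ∀ v w, inner ℂ (H t v) w = inner ℂ v (H t w))
    (hψ : ContinuousOn ψ (Set.Ici t₀)) (hψ' : ∀ t, t₀ < t → HasDerivAt ψ (ψ' t) t)
    (hS : ∀ t, t₀ < t → ψ' t = -(Complex.I • H t (ψ t))) {t : ℝ} (ht : t₀ ≤ t) :
    ‖ψ t‖ ≤ ‖ψ t₀‖ := by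
  have := norm_add_le_of_re_inner_le (U := fun _ => 0) (b := fun _ => 0) hψ continuousOn_const hψ'
    (fun t _ => by simpa using hasDerivAt_const t (0 : ℝ)) (fun _ _ => le_rfl) (fun t ht => by
      rw [hS t ht, re_inner_neg_I_smul (hH t ht)]; simp) ht
  simpa using this

/-- The adiabatic theorem in the form of Kato. Let `P` be a spectral projection of `H`, for the
eigenvalue `ε`, and let `R` solve `(H - ε) R = P' P` with values orthogonal to the range of `P`.
Then `z = (1 - P) ψ - i R ψ` satisfies `z' = -i H z - P P' ψ - i R' ψ`, in which only the last term
changes the norm of `z`. -/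
lemma adiabatic_estimate {H P P' R R' : ℝ → V →L[ℂ] V} {ε b U : ℝ → ℝ} {ψ ψ' : ℝ → V} {t₀ : ℝ}
    (hH : ∀ t, t₀ < t → ∀ v w, inner ℂ (H t v) w = inner ℂ v (H t w))
    (hPs : ∀ t, t₀ < t → ∀ v w, inner ℂ (P t v) w = inner ℂ v (P t w))
    (hPP : ∀ t, t₀ < t → ∀ v, P t (P t v) = P t v)
    (hPH : ∀ t, t₀ < t → ∀ v, P t (H t v) = (ε t : ℂ) • P t v)
    (hP : ∀ t, t₀ < t → HasDerivAt P (P' t) t) (hR : ∀ t, t₀ < t → HasDerivAt R (R' t) t)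
    (hP' : ∀ t, t₀ < t → ∀ v, P' t v = P' t (P t v) + P t (P' t v))
    (hHR : ∀ t, t₀ < t → ∀ v, H t (R t v) - (ε t : ℂ) • R t v = P' t (P t v))
    (hPR : ∀ t, t₀ < t → ∀ v, P t (R t v) = 0) (hRP : ∀ t, t₀ < t → ∀ v, R t (P t v) = R t v)
    (hb : ∀ t, t₀ < t → 0 ≤ b t) (hR' : ∀ t, t₀ < t → ∀ v, ‖R' t v‖ ≤ b t * ‖v‖)
    (hU' : ∀ t, t₀ < t → HasDerivAt U (-b t) t)
    (hPc : ContinuousOn P (Set.Ici t₀)) (hRc : ContinuousOn R (Set.Ici t₀))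
    (hUc : ContinuousOn U (Set.Ici t₀))
    (hψ : ContinuousOn ψ (Set.Ici t₀)) (hψ' : ∀ t, t₀ < t → HasDerivAt ψ (ψ' t) t)
    (hS : ∀ t, t₀ < t → ψ' t = -(Complex.I • H t (ψ t))) (hψ1 : ‖ψ t₀‖ = 1)
    {t : ℝ} (ht : t₀ ≤ t) :
    ‖ψ t - P t (ψ t)‖ ≤ ‖ψ t₀ - P t₀ (ψ t₀)‖ +
      (‖R t (ψ t)‖ + ‖R t₀ (ψ t₀)‖ + (U t₀ - U t)) := by
  set z : ℝ → V := fun s => ψ s - P s (ψ s) - Complex.I • R s (ψ s) with hz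
  have hzc : ContinuousOn z (Set.Ici t₀) :=
    (hψ.sub (hPc.clm_apply hψ)).sub ((hRc.clm_apply hψ).const_smul _)
  have hz' : ∀ s, t₀ < s → HasDerivAt z (-(Complex.I • H s (z s)) - P s (P' s (ψ s)) -
      Complex.I • R' s (ψ s)) s := fun s hs => by
    have hdP : HasDerivAt (fun s => P s (ψ s)) (P' s (ψ s) + P s (ψ' s)) s := by
      have h1 : HasDerivAt (fun s => (P s).restrictScalars ℝ) ((P' s).restrictScalars ℝ) s :=
        (ContinuousLinearMap.restrictScalarsL ℂ V V ℝ ℝ).hasFDerivAt.comp_hasDerivAt s (hP s hs)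
      exact h1.clm_apply (hψ' s hs)
    have hdR : HasDerivAt (fun s => R s (ψ s)) (R' s (ψ s) + R s (ψ' s)) s := by
      have h1 : HasDerivAt (fun s => (R s).restrictScalars ℝ) ((R' s).restrictScalars ℝ) s :=
        (ContinuousLinearMap.restrictScalarsL ℂ V V ℝ ℝ).hasFDerivAt.comp_hasDerivAt s (hR s hs)
      exact h1.clm_apply (hψ' s hs)
    refine (((hψ' s hs).sub hdP).sub (hdR.const_smul Complex.I)).congr_deriv ?_
    have e1 : R s (H s (ψ s)) = (ε s : ℂ) • R s (ψ s) := by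
      rw [← hRP s hs, hPH s hs, map_smul, hRP s hs]
    have e2 : H s (P s (ψ s)) = (ε s : ℂ) • P s (ψ s) := by
      refine ext_inner_left ℂ fun w => ?_
      rw [← hH s hs, ← hPs s hs, hPH s hs, inner_smul_left, inner_smul_right, hPs s hs]
      simp
    have e3 : H s (R s (ψ s)) = P' s (P s (ψ s)) + (ε s : ℂ) • R s (ψ s) :=
      sub_eq_iff_eq_add.1 (hHR s hs _)
    have e4 := hP' s hs (ψ s)
    simp only [hz, hS s hs, map_sub, map_neg, map_smul, hPH s hs, e1, e2, e3]
    nth_rw 1 [e4]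
    simp only [smul_sub, smul_add, smul_neg, smul_smul, ← mul_assoc, Complex.I_mul_I]
    module
  have hψle : ∀ s, t₀ ≤ s → ‖ψ s‖ ≤ 1 := fun s hs =>
    (norm_le_of_schrodinger hH hψ hψ' hS hs).trans hψ1.le
  have hre : ∀ s, t₀ < s → (inner ℂ (z s) (-(Complex.I • H s (z s)) - P s (P' s (ψ s)) -
      Complex.I • R' s (ψ s))).re ≤ ‖z s‖ * b s := fun s hs => by
    have hPz : P s (z s) = 0 := by
      simp only [hz, map_sub, map_smul, hPP s hs, hPR s hs, sub_self, smul_zero]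
    rw [inner_sub_right, inner_sub_right, ← hPs s hs, hPz, inner_zero_left, Complex.sub_re,
      Complex.sub_re, re_inner_neg_I_smul (hH s hs), Complex.zero_re, sub_zero, zero_sub]
    refine (neg_le_abs _).trans ((Complex.abs_re_le_norm _).trans ((norm_inner_le_norm _ _).trans ?_))
    rw [norm_smul, Complex.norm_I, one_mul]
    refine mul_le_mul_of_nonneg_left ((hR' s hs _).trans ?_) (norm_nonneg _)
    exact mul_le_of_le_one_right (hb s hs) (hψle s hs.le)
  have key := norm_add_le_of_re_inner_le hzc hUc hz' hU' hb hre ht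
  have h1 : ‖ψ t - P t (ψ t)‖ ≤ ‖z t‖ + ‖R t (ψ t)‖ := by
    have := norm_add_le (z t) (Complex.I • R t (ψ t))
    rwa [norm_smul, Complex.norm_I, one_mul, hz, sub_add_cancel] at this
  have h2 : ‖z t₀‖ ≤ ‖ψ t₀ - P t₀ (ψ t₀)‖ + ‖R t₀ (ψ t₀)‖ := by
    have := norm_sub_le (ψ t₀ - P t₀ (ψ t₀)) (Complex.I • R t₀ (ψ t₀))
    rwa [norm_smul, Complex.norm_I, one_mul] at this
  linarith

end Adiabatic

/-! ### Real matrices as operators on the state space -/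

section RealOp

variable {ι : Type*} [Fintype ι] [DecidableEq ι]

/-- The operator on the complex Euclidean space given by a real matrix. -/
noncomputable def realOp : Matrix ι ι ℝ →+* (EuclideanSpace ℂ ι →L[ℂ] EuclideanSpace ℂ ι) :=
  ((Matrix.toEuclideanCLM (𝕜 := ℂ) (n := ι)).toRingEquiv : Matrix ι ι ℂ →+* _).comp
    Complex.ofRealHom.mapMatrix

lemma realOp_apply (M : Matrix ι ι ℝ) (v : EuclideanSpace ℂ ι) :
    (realOp M v).ofLp = M.map Complex.ofRealHom *ᵥ v.ofLp := by
  change (Matrix.toEuclideanCLM (𝕜 := ℂ) (n := ι) (M.map Complex.ofRealHom) v).ofLp = _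
  simp

lemma realOp_smul (c : ℝ) (M : Matrix ι ι ℝ) : realOp (c • M) = (c : ℂ) • realOp M := by
  ext v x
  rw [realOp_apply]
  change _ = (c : ℂ) * (realOp M v).ofLp x
  rw [realOp_apply, show (c • M).map Complex.ofRealHom = (c : ℂ) • M.map Complex.ofRealHom by
    ext; simp, smul_mulVec]
  rfl

lemma inner_realOp {M : Matrix ι ι ℝ} (hM : Mᵀ = M) (v w : EuclideanSpace ℂ ι) :
    inner ℂ (realOp M v) w = inner ℂ v (realOp M w) := by
  have h : star (realOp M) = realOp M := by
    change star (Matrix.toEuclideanCLM (𝕜 := ℂ) (n := ι) (M.map Complex.ofRealHom)) =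
      Matrix.toEuclideanCLM (𝕜 := ℂ) (n := ι) (M.map Complex.ofRealHom)
    rw [← map_star]
    congr 1
    ext x y
    have := congrFun (congrFun hM x) y
    simp only [transpose_apply] at this
    simp [Matrix.star_apply, this]
  rw [ContinuousLinearMap.star_eq_adjoint] at h
  conv_lhs => rw [← h]
  exact ContinuousLinearMap.adjoint_inner_left _ _ _

lemma realOp_eq_sum (M : Matrix ι ι ℝ) :
    realOp M = ∑ x, ∑ y, (M x y : ℂ) • realOp (Matrix.single x y (1 : ℝ)) := by
  conv_lhs => rw [Matrix.matrix_eq_sum_single M]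
  simp only [map_sum]
  refine Finset.sum_congr rfl fun x _ => Finset.sum_congr rfl fun y _ => ?_
  have : Matrix.single x y (M x y) = M x y • Matrix.single x y (1 : ℝ) := by
    rw [Matrix.smul_single, smul_eq_mul, mul_one]
  rw [this, realOp_smul]

lemma hasDerivAt_realOp {M : ℝ → Matrix ι ι ℝ} {M' : Matrix ι ι ℝ} {t : ℝ}
    (h : HasEntryDeriv M M' t) : HasDerivAt (fun s => realOp (M s)) (realOp M') t := by
  rw [realOp_eq_sum M']
  simp only [fun s => realOp_eq_sum (M s)]
  exact HasDerivAt.fun_sum fun x _ => HasDerivAt.fun_sum fun y _ =>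
    (h x y).ofReal_comp.smul_const (realOp (Matrix.single x y (1 : ℝ)))

lemma norm_realOp_apply_le (M : Matrix ι ι ℝ) (v : EuclideanSpace ℂ ι) :
    ‖realOp M v‖ ≤ (∑ x, ∑ y, |M x y|) * ‖v‖ := by
  have hsingle : ∀ x y, ‖realOp (Matrix.single x y (1 : ℝ)) v‖ ≤ ‖v‖ := fun x y => by
    have : realOp (Matrix.single x y (1 : ℝ)) v = EuclideanSpace.single x (v y) := by
      ext z
      rw [realOp_apply]
      by_cases h : z = x
      · subst h; simp [mulVec, dotProduct, Matrix.single_apply]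
      · simp [mulVec, dotProduct, h, Ne.symm h]
    rw [this, PiLp.norm_single]
    exact PiLp.norm_apply_le v y
  rw [realOp_eq_sum, Finset.sum_mul, _root_.sum_apply]
  refine (norm_sum_le _ _).trans (Finset.sum_le_sum fun x _ => ?_)
  rw [Finset.sum_mul, _root_.sum_apply]
  refine (norm_sum_le _ _).trans (Finset.sum_le_sum fun y _ => ?_)
  rw [_root_.smul_apply, norm_smul, Complex.norm_real, Real.norm_eq_abs]
  exact mul_le_mul_of_nonneg_left (hsingle x y) (abs_nonneg _)

end RealOp

section States

variable {N : ℕ}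

lemma toEuclideanLin_map_ofReal (M : Matrix (SpinConfig N) (SpinConfig N) ℝ) (v : StateSpace N) :
    Matrix.toEuclideanLin (M.map Complex.ofRealHom) v = realOp M v := by
  ext x
  rw [realOp_apply]
  rfl

lemma mem_groundSpace_iff_realOp {M : Matrix (SpinConfig N) (SpinConfig N) ℝ} (v : StateSpace N) :
    v ∈ groundSpace (M.map Complex.ofRealHom) ↔
      realOp M v = (minEnergy (M.map Complex.ofRealHom) : ℂ) • v := by
  rw [groundSpace, energySpace, Module.End.mem_eigenspace_iff, toEuclideanLin_map_ofReal]

/-- Each `σᵢˣ` permutes the basis, so `∑ᵢ σᵢˣ` has norm at most `N`. -/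
lemma norm_realOp_hopping_le (v : StateSpace N) : ‖realOp (hopping N) v‖ ≤ N * ‖v‖ := by
  have h : realOp (hopping N) v =
      ∑ i : Fin N, WithLp.toLp 2 fun x => v (spinFlip i x) := by
    ext x
    rw [realOp_apply]
    simp only [mulVec, dotProduct, Matrix.map_apply, hopping, of_apply, map_sum, Finset.sum_mul]
    rw [Finset.sum_comm]
    simp
  have h2 : ∀ i : Fin N, ‖(WithLp.toLp 2 fun x => v (spinFlip i x) : StateSpace N)‖ = ‖v‖ :=
    fun i => by
      rw [EuclideanSpace.norm_eq, EuclideanSpace.norm_eq]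
      congr 1
      exact (Function.Involutive.bijective (spinFlip_spinFlip i)).sum_comp fun x => ‖v x‖ ^ 2
  rw [h]
  refine (norm_sum_le _ _).trans ?_
  simp [h2]

variable {E : SpinConfig N → ℝ} {g : ℝ}

lemma realOp_groundProj_mem (hN : 1 ≤ N) (hg : 0 < g) (ψ : StateSpace N) :
    realOp (groundProj E g) ψ ∈ groundSpace ((realTfim E g).map Complex.ofRealHom) := by
  rw [mem_groundSpace_iff_realOp, ← mul_apply_eq_comp, ← map_mul,
    realTfim_mul_groundProj hN hg, realOp_smul]
  rfl

lemma realOp_groundProj_of_mem (hN : 1 ≤ N) (hg : 0 < g) {w : StateSpace N}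
    (hw : w ∈ groundSpace ((realTfim E g).map Complex.ofRealHom)) :
    realOp (groundProj E g) w = w := by
  rw [groundSpace, mem_energySpace_iff, map_ofReal_mulVec_eq_smul_iff] at hw
  have h : (groundProj E g).map Complex.ofRealHom *ᵥ w.ofLp = ((1 : ℝ) : ℂ) • w.ofLp := by
    rw [map_ofReal_mulVec_eq_smul_iff, one_smul, one_smul]
    exact ⟨groundProj_mulVec_of_ground hN hg hw.1, groundProj_mulVec_of_ground hN hg hw.2⟩
  ext x
  rw [realOp_apply, h]
  simp

lemma excitationAmplitude_realTfim (hN : 1 ≤ N) (hg : 0 < g) (ψ : StateSpace N) :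
    excitationAmplitude ((realTfim E g).map Complex.ofRealHom) ψ =
      ‖ψ - realOp (groundProj E g) ψ‖ := by
  rw [excitationAmplitude]
  congr 2
  refine Submodule.eq_starProjection_of_mem_of_inner_eq_zero (realOp_groundProj_mem hN hg ψ) ?_
  intro w hw
  rw [← realOp_groundProj_of_mem hN hg hw, ← inner_realOp groundProj_transpose, map_sub,
    ← mul_apply_eq_comp, ← map_mul, groundProj_mul_self hN hg, sub_self,
    inner_zero_left]

end States

/-! ### The power-law schedule -/

section Schedule

open Filter Topology

variable {N : ℕ} {a c δ : ℝ}

lemma one_le_two_mul_sub_one (hN : 1 ≤ N) : (1 : ℝ) ≤ 2 * N - 1 := by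
  have : (1 : ℝ) ≤ N := by exact_mod_cast hN
  linarith

lemma powerSchedule_pos (ha : 0 < a) {t : ℝ} (ht : 0 < δ * t + c) :
    0 < powerSchedule N a c δ t :=
  mul_pos ha (Real.rpow_pos_of_pos ht _)

/-- The schedule obeys the autonomous equation `Γ' = -β Γ²ᴺ`. -/
lemma hasDerivAt_powerSchedule (hN : 1 ≤ N) (ha : 0 < a) {t : ℝ} (ht : 0 < δ * t + c) :
    HasDerivAt (powerSchedule N a c δ)
      (-(δ / ((2 * N - 1) * a ^ (2 * N - 1)) * powerSchedule N a c δ t ^ (2 * N))) t := by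
  have h1 : HasDerivAt (fun s => δ * s + c) δ t := by
    simpa using ((hasDerivAt_id t).const_mul δ).add_const c
  refine ((h1.rpow_const (p := -(1 / (2 * (N : ℝ) - 1))) (Or.inl ht.ne')).const_mul a).congr_deriv ?_
  have hm := one_le_two_mul_sub_one hN
  have hm0 : 2 * (N : ℝ) - 1 ≠ 0 := by linarith
  have h2 : ((δ * t + c) ^ (-(1 / (2 * (N : ℝ) - 1)))) ^ (2 * N) =
      (δ * t + c) ^ (-(1 / (2 * (N : ℝ) - 1)) - 1) := by
    rw [← Real.rpow_natCast, ← Real.rpow_mul ht.le]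
    congr 1
    push_cast
    field_simp
    ring
  have h3 : a ^ (2 * N) = a ^ (2 * N - 1) * a := by
    rw [← pow_succ]; congr 1; omega
  rw [powerSchedule, mul_pow, h2, h3]
  have := pow_pos ha (2 * N - 1)
  field_simp

lemma powerSchedule_anti (hN : 1 ≤ N) (ha : 0 < a) (hδ : 0 < δ) {t₀ t : ℝ}
    (ht₀ : 0 < δ * t₀ + c) (h : t₀ ≤ t) : powerSchedule N a c δ t ≤ powerSchedule N a c δ t₀ := by
  have hm := one_le_two_mul_sub_one hN
  refine mul_le_mul_of_nonneg_left (Real.rpow_le_rpow_of_nonpos ht₀ ?_ ?_) ha.le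
  · have := mul_le_mul_of_nonneg_left h hδ.le
    linarith
  · have : 0 < 1 / (2 * (N : ℝ) - 1) := by positivity
    linarith

lemma tendsto_powerSchedule (hN : 1 ≤ N) :
    Tendsto (fun s : ℝ => a * s ^ (-(1 / (2 * (N : ℝ) - 1)))) atTop (𝓝 0) := by
  have hm := one_le_two_mul_sub_one hN
  simpa using (tendsto_rpow_neg_atTop (y := 1 / (2 * (N : ℝ) - 1)) (by positivity)).const_mul a

lemma tendsto_powerSchedule_time (hN : 1 ≤ N) (hδ : 0 < δ) :
    Tendsto (powerSchedule N a c δ) atTop (𝓝 0) :=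
  (tendsto_powerSchedule hN).comp
    (tendsto_atTop_add_const_right _ c (tendsto_id.const_mul_atTop hδ))

lemma eventually_admissible (hN : 1 ≤ N) {Γ₀ : ℝ} (hΓ₀ : 0 < Γ₀) :
    ∀ᶠ s : ℝ in atTop, 0 < s ∧ a * s ^ (-(1 / (2 * (N : ℝ) - 1))) ≤ Γ₀ :=
  (eventually_gt_atTop 0).and ((tendsto_powerSchedule hN).eventually (eventually_le_nhds hΓ₀))

/-- The prefactor is the least one for which the speed `β` of the schedule is at most `δ A² / N`. -/
lemma speed_mul_le (hN : 1 ≤ N) {A : ℝ} (hA : 0 < A) (hδ : 0 < δ)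
    (ha : schedulePrefactor N A ≤ a) :
    0 < a ∧ δ / ((2 * N - 1) * a ^ (2 * N - 1)) * N ≤ δ * A ^ 2 := by
  have hm := one_le_two_mul_sub_one hN
  have hN0 : (0 : ℝ) < N := by exact_mod_cast hN
  have hT : 0 < (N : ℝ) / ((2 * N - 1) * A ^ 2) := by positivity
  have hpos : 0 < schedulePrefactor N A := Real.rpow_pos_of_pos hT _
  have hcast : 2 * (N : ℝ) - 1 = ((2 * N - 1 : ℕ) : ℝ) := by
    rw [Nat.cast_sub (by omega)]; push_cast; ring
  have hpow : (N : ℝ) / ((2 * N - 1) * A ^ 2) ≤ a ^ (2 * N - 1) := by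
    have h1 : schedulePrefactor N A ^ (2 * N - 1) = (N : ℝ) / ((2 * N - 1) * A ^ 2) := by
      rw [schedulePrefactor, one_div, hcast]
      exact Real.rpow_inv_natCast_pow (by rw [← hcast]; exact hT.le) (by omega)
    rw [← h1]
    gcongr
  have ha0 : 0 < a := hpos.trans_le ha
  refine ⟨ha0, ?_⟩
  have hap := pow_pos ha0 (2 * N - 1)
  rw [div_le_iff₀ (by positivity)] at hpow
  rw [div_mul_eq_mul_div, div_le_iff₀ (by positivity)]
  calc δ * N ≤ δ * (a ^ (2 * N - 1) * ((2 * N - 1) * A ^ 2)) := by gcongr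
    _ = _ := by ring

end Schedule

/-! ### Adiabaticity and convergence of the evolution -/

section Evolution

variable {N : ℕ} {E : SpinConfig N → ℝ}

lemma HasEntryDeriv.comp {ι : Type*} {M : ℝ → Matrix ι ι ℝ} {M' : Matrix ι ι ℝ} {f : ℝ → ℝ}
    {f' t : ℝ} (hM : HasEntryDeriv M M' (f t)) (hf : HasDerivAt f f' t) :
    HasEntryDeriv (fun s => M (f s)) (f' • M') t := fun x y =>
  ((hM x y).comp t hf).congr_deriv (mul_comm _ _)

lemma HasEntryDeriv.const_smul {ι : Type*} {M : ℝ → Matrix ι ι ℝ} {M' : Matrix ι ι ℝ} {t : ℝ}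
    (hM : HasEntryDeriv M M' t) (b : ℝ) : HasEntryDeriv (fun s => b • M s) (b • M') t :=
  fun x y => (hM x y).const_mul b

/-- A schedule with `Γ' = -β Γ²ᴺ` and a gap of at least `A Γᴺ` satisfies the adiabaticity condition
with the bound `β N / A²`. -/
lemma adiabaticAt_of_speed (hN : 1 ≤ N) {A β δ t : ℝ} {Γ : ℝ → ℝ} (hA : 0 < A) (hβ : 0 < β)
    (hβδ : β * N ≤ δ * A ^ 2) (hΓ : HasDerivAt Γ (-(β * Γ t ^ (2 * N))) t) (hΓt : 0 < Γ t)
    (hgap : ∀ e ∈ energyLevels ((realTfim E (Γ t)).map Complex.ofRealHom),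
      e ≠ groundEnergy E (Γ t) → A * Γ t ^ N ≤ e - groundEnergy E (Γ t)) :
    AdiabaticAt (fun s => (realTfim E (Γ s)).map Complex.ofRealHom) δ t := by
  refine ⟨finrank_groundSpace hN hΓt, ((β * Γ t ^ (2 * N)) • hopping N).map Complex.ofRealHom, ?_, ?_⟩
  · refine hasDerivAt_pi.2 fun x => hasDerivAt_pi.2 fun y => ?_
    have h1 := ((hΓ.mul_const (hopping N x y)).const_sub (diagonal E x y)).ofReal_comp
    refine h1.congr_deriv ?_
    simp
  · intro v₀ _ hv₀ e he hne v _ hv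
    rw [toEuclideanLin_map_ofReal, realOp_smul]
    have hpos : 0 < β * Γ t ^ (2 * N) := by positivity
    have hne' : e ≠ groundEnergy E (Γ t) := hne
    have hgap' := hgap e he hne'
    have hΔ : 0 < A * Γ t ^ N := by positivity
    have h1 : ‖inner ℂ v ((((β * Γ t ^ (2 * N) : ℝ) : ℂ) • realOp (hopping N)) v₀)‖ ≤
        β * Γ t ^ (2 * N) * N := by
      refine (norm_inner_le_norm _ _).trans ?_
      rw [hv, one_mul, _root_.smul_apply, norm_smul, Complex.norm_real, Real.norm_eq_abs,
        abs_of_pos hpos]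
      refine mul_le_mul_of_nonneg_left ?_ hpos.le
      simpa [hv₀] using norm_realOp_hopping_le v₀
    have h2 : (A * Γ t ^ N) ^ 2 ≤ (e - minEnergy ((realTfim E (Γ t)).map Complex.ofRealHom)) ^ 2 :=
      pow_le_pow_left₀ hΔ.le hgap' 2
    have h3 : 0 < (A * Γ t ^ N) ^ 2 := by positivity
    rw [div_le_iff₀ (h3.trans_le h2)]
    have hδ : 0 < δ := by
      have hN0 : (0 : ℝ) < N := by exact_mod_cast hN
      have : 0 < δ * A ^ 2 := lt_of_lt_of_le (by positivity) hβδ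
      exact pos_of_mul_pos_left this (by positivity)
    refine le_trans h1 (le_trans ?_ (mul_le_mul_of_nonneg_left h2 hδ.le))
    calc β * Γ t ^ (2 * N) * N = (β * N) * Γ t ^ (2 * N) := by ring
      _ ≤ (δ * A ^ 2) * Γ t ^ (2 * N) := by gcongr
      _ = δ * (A * Γ t ^ N) ^ 2 := by rw [mul_pow, ← pow_mul, mul_comm N 2]; ring

/-- Along a schedule with `Γ' = -β Γ²ᴺ` the excitation amplitude grows by at most a multiple of `β`,
because the boundary terms and the variation of `R = -β G(Γ)` in the adiabatic estimate are all
proportional to `β`. -/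
lemma exists_excitationAmplitude_le (hN : 1 ≤ N) {Γ₀ A : ℝ} (hΓ₀ : 0 < Γ₀) (hA : 0 < A)
    (hgap : ∀ g, 0 < g → g ≤ Γ₀ → ∀ e ∈ energyLevels ((realTfim E g).map Complex.ofRealHom),
      e ≠ groundEnergy E g → A * g ^ N ≤ e - groundEnergy E g) :
    ∃ D : ℝ, 0 ≤ D ∧ ∀ (β t₀ : ℝ) (Γ : ℝ → ℝ) (ψ : ℝ → StateSpace N), 0 < β →
      (∀ t, t₀ ≤ t → HasDerivAt Γ (-(β * Γ t ^ (2 * N))) t) →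
      (∀ t, t₀ ≤ t → 0 < Γ t ∧ Γ t ≤ Γ₀) →
      SolvesSchrodinger (fun s => (realTfim E (Γ s)).map Complex.ofRealHom) t₀ ψ → ‖ψ t₀‖ = 1 →
      ∀ t, t₀ ≤ t → ‖ψ t‖ ≤ 1 ∧
        ‖ψ t - realOp (groundProj E (Γ t)) (ψ t)‖ ≤
          ‖ψ t₀ - realOp (groundProj E (Γ t₀)) (ψ t₀)‖ + D * β := by
  obtain ⟨G', V, D, hG', hV', hV, hG⟩ := exists_transitionOp_variation hN hΓ₀ hA hgap
  obtain ⟨P', -, hP'⟩ := (entriesIn_smooth (E := E) hN).1.exists_entryDeriv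
  refine ⟨4 * D, ?_, ?_⟩
  · have := (abs_nonneg _).trans (hV Γ₀ hΓ₀ le_rfl)
    linarith
  intro β t₀ Γ ψ hβ hΓ' hΓ hψ hψ1 t ht
  obtain ⟨hψc, hψd⟩ := hψ
  have hψd' : ∀ s, t₀ < s →
      HasDerivAt ψ (-(Complex.I • realOp (realTfim E (Γ s)) (ψ s))) s := fun s hs => by
    obtain ⟨ψ', h1, h2⟩ := hψd s hs
    rw [toEuclideanLin_map_ofReal] at h2
    rw [← h2, smul_smul, Complex.I_mul_I, neg_smul, one_smul, neg_neg]
    exact h1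
  have hH : ∀ s, t₀ < s → ∀ v w, inner ℂ (realOp (realTfim E (Γ s)) v) w =
      inner ℂ v (realOp (realTfim E (Γ s)) w) := fun s _ => inner_realOp realTfim_transpose
  have hψle : ∀ s, t₀ ≤ s → ‖ψ s‖ ≤ 1 := fun s hs =>
    (norm_le_of_schrodinger hH hψc hψd' (fun _ _ => rfl) hs).trans hψ1.le
  refine ⟨hψle t ht, ?_⟩
  have hPd : ∀ s, t₀ ≤ s → HasEntryDeriv (fun s => groundProj E (Γ s))
      (-(β * Γ s ^ (2 * N)) • P' (Γ s)) s := fun s hs => (hP' _ (hΓ s hs).1).comp (hΓ' s hs)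
  have hRd : ∀ s, t₀ ≤ s → HasEntryDeriv (fun s => (-β) • transitionOp E (Γ s))
      ((-β) • -(β * Γ s ^ (2 * N)) • G' (Γ s)) s := fun s hs =>
    ((hG' _ (hΓ s hs).1).comp (hΓ' s hs)).const_smul (-β)
  have hUd : ∀ s, t₀ ≤ s → HasDerivAt (fun s => β * V (Γ s))
      (-(β * (β * Γ s ^ (2 * N)) * ∑ x, ∑ y, |G' (Γ s) x y|)) s := fun s hs =>
    (((hV' _ (hΓ s hs).1).comp s (hΓ' s hs)).const_mul β).congr_deriv (by ring)
  have hΓN : ∀ s, t₀ ≤ s → 0 < Γ s ^ (2 * N) := fun s hs => pow_pos (hΓ s hs).1 _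
  have key := adiabatic_estimate (H := fun s => realOp (realTfim E (Γ s)))
    (P := fun s => realOp (groundProj E (Γ s)))
    (P' := fun s => realOp (-(β * Γ s ^ (2 * N)) • P' (Γ s)))
    (R := fun s => realOp ((-β) • transitionOp E (Γ s)))
    (R' := fun s => realOp ((-β) • -(β * Γ s ^ (2 * N)) • G' (Γ s)))
    (ε := fun s => groundEnergy E (Γ s)) (U := fun s => β * V (Γ s))
    (b := fun s => β * (β * Γ s ^ (2 * N)) * ∑ x, ∑ y, |G' (Γ s) x y|) (ψ := ψ) hH
    (fun s _ => inner_realOp groundProj_transpose)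
    (fun s hs v => by
      rw [← mul_apply_eq_comp, ← map_mul, groundProj_mul_self hN (hΓ s hs.le).1])
    (fun s hs v => by
      rw [← mul_apply_eq_comp, ← map_mul, groundProj_mul_realTfim hN (hΓ s hs.le).1, realOp_smul]
      rfl)
    (fun s hs => hasDerivAt_realOp (hPd s hs.le)) (fun s hs => hasDerivAt_realOp (hRd s hs.le))
    (fun s hs v => by
      rw [← mul_apply_eq_comp, ← mul_apply_eq_comp, ← map_mul, ← map_mul,
        ← _root_.add_apply, ← map_add, smul_mul_assoc, mul_smul_comm, ← smul_add,
        ← entryDeriv_groundProj_eq hN (hΓ s hs.le).1 (hP' _ (hΓ s hs.le).1)])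
    (fun s hs v => by
      rw [← mul_apply_eq_comp, ← mul_apply_eq_comp, ← _root_.smul_apply,
        ← _root_.sub_apply, ← map_mul, ← map_mul, ← realOp_smul, ← map_sub]
      congr 2
      have h1 := sub_mul_transitionOp (E := E) hN (hΓ s hs.le).1
      rw [sub_mul, smul_mul_assoc, one_mul] at h1
      rw [mul_smul_comm, smul_comm (groundEnergy E (Γ s)), ← smul_sub, h1, smul_mul_assoc,
        entryDeriv_mul_groundProj hN (hΓ s hs.le).1 (hP' _ (hΓ s hs.le).1), smul_smul, neg_mul])
    (fun s hs v => by
      rw [← mul_apply_eq_comp, ← map_mul, mul_smul_comm,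
        groundProj_mul_transitionOp hN (hΓ s hs.le).1, smul_zero, map_zero]
      rfl)
    (fun s hs v => by
      rw [← mul_apply_eq_comp, ← map_mul, smul_mul_assoc,
        transitionOp_mul_groundProj hN (hΓ s hs.le).1])
    (fun s hs => mul_nonneg (by have := hΓN s hs.le; positivity)
      (Finset.sum_nonneg fun x _ => Finset.sum_nonneg fun y _ => abs_nonneg _))
    (fun s hs v => by
      rw [smul_smul, neg_mul_neg]
      refine (norm_realOp_apply_le _ _).trans_eq ?_
      have := hΓN s hs.le
      simp only [Matrix.smul_apply, smul_eq_mul, abs_mul, abs_of_pos hβ, abs_of_pos this,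
        ← Finset.mul_sum])
    (fun s hs => hUd s hs.le)
    (fun s hs => (hasDerivAt_realOp (hPd s hs)).continuousAt.continuousWithinAt)
    (fun s hs => (hasDerivAt_realOp (hRd s hs)).continuousAt.continuousWithinAt)
    (fun s hs => (hUd s hs).continuousAt.continuousWithinAt)
    hψc hψd' (fun _ _ => rfl) hψ1 ht
  have hRb : ∀ s, t₀ ≤ s → ‖realOp ((-β) • transitionOp E (Γ s)) (ψ s)‖ ≤ β * D := fun s hs => by
    refine (norm_realOp_apply_le _ _).trans ?_
    have h1 := hG (Γ s) (hΓ s hs).1 (hΓ s hs).2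
    simp only [Matrix.smul_apply, smul_eq_mul, abs_mul, abs_neg, abs_of_pos hβ, ← Finset.mul_sum]
    refine (mul_le_of_le_one_right ?_ (hψle s hs)).trans (mul_le_mul_of_nonneg_left h1 hβ.le)
    exact mul_nonneg hβ.le (Finset.sum_nonneg fun x _ => Finset.sum_nonneg fun y _ => abs_nonneg _)
  have h1 := hRb t ht
  have h2 := hRb t₀ le_rfl
  have h3 : β * V (Γ t₀) - β * V (Γ t) ≤ β * (2 * D) := by
    rw [← mul_sub]
    refine mul_le_mul_of_nonneg_left ?_ hβ.le
    have h4 := abs_le.1 (hV (Γ t₀) (hΓ t₀ le_rfl).1 (hΓ t₀ le_rfl).2)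
    have h5 := abs_le.1 (hV (Γ t) (hΓ t ht).1 (hΓ t ht).2)
    linarith [h4.2, h5.1]
  linarith

lemma exists_classical_gap (E : SpinConfig N → ℝ) (Em : ℝ) (h : ∀ x, Em ≤ E x) :
    ∃ κ > 0, ∀ x, E x ≠ Em → κ ≤ E x - Em := by
  by_cases hne : Nonempty {x // E x ≠ Em}
  · obtain ⟨x, hx⟩ := Finite.exists_min fun x : {x // E x ≠ Em} => E x - Em
    exact ⟨E x - Em, sub_pos.2 (lt_of_le_of_ne (h x) (Ne.symm x.2)), fun y hy => hx ⟨y, hy⟩⟩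
  · exact ⟨1, one_pos, fun x hx => absurd ⟨⟨x, hx⟩⟩ hne⟩

/-- In a weak field the ground states have small components on the excited configurations. -/
lemma sum_excited_sq_le {g : ℝ} (hg : 0 < g) {Em κ : ℝ} (hEm : ∃ x, E x ≤ Em)
    (hle : ∀ x, Em ≤ E x) (hκ : ∀ x, E x ≠ Em → κ ≤ E x - Em) {f : SpinConfig N → ℝ}
    (hf : realTfim E g *ᵥ f = groundEnergy E g • f) :
    κ * ∑ x, (if E x = Em then 0 else f x ^ 2) ≤ g * N * (f ⬝ᵥ f) := by
  have h1 : f ⬝ᵥ realTfim E g *ᵥ f = groundEnergy E g * (f ⬝ᵥ f) := by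
    rw [hf, dotProduct_smul, smul_eq_mul]
  have h2 : f ⬝ᵥ realTfim E g *ᵥ f = ∑ x, E x * f x ^ 2 - g * (f ⬝ᵥ hopping N *ᵥ f) := by
    rw [realTfim, sub_mulVec, smul_mulVec, dotProduct_sub, dotProduct_smul, smul_eq_mul]
    congr 1
    exact Finset.sum_congr rfl fun x _ => by rw [mulVec_diagonal]; ring
  obtain ⟨x₀, hx₀⟩ := hEm
  have hff : 0 ≤ f ⬝ᵥ f := Finset.sum_nonneg fun x _ => mul_self_nonneg _
  have h3 := mul_le_mul_of_nonneg_right ((groundEnergy_le E g x₀).trans hx₀) hff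
  have h4 := mul_le_mul_of_nonneg_left (abs_le.1 (dotProduct_hopping_mulVec_le f)).2 hg.le
  have h5 : κ * ∑ x, (if E x = Em then 0 else f x ^ 2) ≤ ∑ x, (E x - Em) * f x ^ 2 := by
    rw [Finset.mul_sum]
    refine Finset.sum_le_sum fun x _ => ?_
    split_ifs with h
    · rw [mul_zero]; exact mul_nonneg (sub_nonneg.2 (hle x)) (sq_nonneg _)
    · exact mul_le_mul_of_nonneg_right (hκ x h) (sq_nonneg _)
  have h6 : ∑ x, (E x - Em) * f x ^ 2 = ∑ x, E x * f x ^ 2 - Em * (f ⬝ᵥ f) := by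
    simp only [sub_mul, Finset.sum_sub_distrib, dotProduct, Finset.mul_sum, sq]
  linarith

lemma norm_realOp_groundProj_le (hN : 1 ≤ N) {g : ℝ} (hg : 0 < g) (ψ : StateSpace N) :
    ‖realOp (groundProj E g) ψ‖ ≤ ‖ψ‖ := by
  have h1 : inner ℂ (realOp (groundProj E g) ψ) (realOp (groundProj E g) ψ) =
      inner ℂ ψ (realOp (groundProj E g) ψ) := by
    rw [inner_realOp groundProj_transpose, ← mul_apply_eq_comp, ← map_mul,
      groundProj_mul_self hN hg]
  have h2 := norm_inner_le_norm (𝕜 := ℂ) ψ (realOp (groundProj E g) ψ)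
  rw [← h1, inner_self_eq_norm_sq_to_K, norm_pow, RCLike.norm_ofReal, abs_norm, sq] at h2
  rcases (norm_nonneg (realOp (groundProj E g) ψ)).eq_or_lt with h | h
  · rw [← h]; exact norm_nonneg _
  · exact le_of_mul_le_mul_right h2 h

/-- The excitation amplitude with respect to the Ising Hamiltonian is at most that in a weak field,
up to an error that vanishes with the field. -/
lemma exists_ising_excitationAmplitude_le (hN : 1 ≤ N) (E : SpinConfig N → ℝ) :
    ∃ κ > 0, ∀ g, 0 < g → ∀ ψ : StateSpace N, ‖ψ‖ ≤ 1 →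
      excitationAmplitude ((diagonal E).map Complex.ofRealHom) ψ ≤
        ‖ψ - realOp (groundProj E g) ψ‖ + √(g * N / κ) := by
  set Em := minEnergy ((diagonal E).map Complex.ofRealHom) with hEm
  have hle : ∀ x, Em ≤ E x := fun x => (minEnergy_diagonal_le E x).1
  have hex : ∃ x, E x ≤ Em := exists_le_minEnergy_diagonal E
  obtain ⟨κ, hκ, hgap⟩ := exists_classical_gap E Em hle
  refine ⟨κ, hκ, fun g hg ψ hψ => ?_⟩
  set θ := realOp (groundProj E g) ψ with hθ
  have hθ1 : ‖θ‖ ≤ 1 := (norm_realOp_groundProj_le hN hg ψ).trans hψ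
  have hθg := realOp_groundProj_mem (E := E) hN hg ψ
  rw [← hθ, groundSpace, mem_energySpace_iff, map_ofReal_mulVec_eq_smul_iff] at hθg
  set w : StateSpace N := WithLp.toLp 2 fun x => if E x = Em then θ x else 0 with hw
  have hwmem : w ∈ groundSpace ((diagonal E).map Complex.ofRealHom) := by
    rw [groundSpace, mem_energySpace_iff, ← hEm, diagonal_map (by simp)]
    ext x
    rw [mulVec_diagonal]
    by_cases h : E x = Em <;> simp [hw, h]
  have hmin : excitationAmplitude ((diagonal E).map Complex.ofRealHom) ψ ≤ ‖ψ - w‖ := by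
    rw [excitationAmplitude, Submodule.starProjection_minimal]
    exact ciInf_le ⟨0, by rintro _ ⟨_, rfl⟩; exact norm_nonneg _⟩
      (⟨w, hwmem⟩ : groundSpace ((diagonal E).map Complex.ofRealHom))
  have hsq : ‖θ - w‖ ^ 2 ≤ g * N / κ := by
    rw [le_div_iff₀ hκ, EuclideanSpace.norm_sq_eq]
    have h1 := sum_excited_sq_le hg hex hle hgap hθg.1
    have h2 := sum_excited_sq_le hg hex hle hgap hθg.2
    have h3 : ∑ x, ‖(θ - w) x‖ ^ 2 = ∑ x, (if E x = Em then 0 else (θ x).re ^ 2) +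
        ∑ x, (if E x = Em then 0 else (θ x).im ^ 2) := by
      rw [← Finset.sum_add_distrib]
      refine Finset.sum_congr rfl fun x _ => ?_
      by_cases h : E x = Em
      · simp [hw, h]
      · simp only [hw, h, if_false, PiLp.sub_apply, sub_zero]
        rw [Complex.sq_norm, Complex.normSq_apply]; ring
    have h4 : (fun x => (θ x).re) ⬝ᵥ (fun x => (θ x).re) +
        (fun x => (θ x).im) ⬝ᵥ (fun x => (θ x).im) = ‖θ‖ ^ 2 := by
      rw [EuclideanSpace.norm_sq_eq, dotProduct, dotProduct, ← Finset.sum_add_distrib]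
      exact Finset.sum_congr rfl fun x _ => by rw [Complex.sq_norm, Complex.normSq_apply]
    have h5 : g * N * ‖θ‖ ^ 2 ≤ g * N :=
      mul_le_of_le_one_right (by positivity) (pow_le_one₀ (norm_nonneg _) hθ1)
    rw [h3]
    rw [← h4] at h5
    linarith
  have h6 : ‖θ - w‖ ≤ √(g * N / κ) := Real.le_sqrt_of_sq_le hsq
  have h7 : ‖ψ - w‖ ≤ ‖ψ - θ‖ + ‖θ - w‖ := norm_sub_le_norm_sub_add_norm_sub _ _ _
  linarith

end Evolution

end

theorem mainTheorem3 (K L Γ₀ : ℝ) (hΓ₀ : 0 < Γ₀) :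
    -- bounds `a₁, a₂` that do not depend on the number of spins or on the couplings
    ∃ a₁ a₂ : ℝ, 0 < a₁ ∧
      ∀ (N : ℕ), 1 ≤ N →
      ∀ (J : Finset (Fin N) → ℝ) (Emin Emax Eplus A : ℝ),
        Emin = minEnergy (isingHamiltonian J) →
        Emax = maxEnergy (isingHamiltonian J) →
        -- extensivity
        -(K * N) ≤ Emin → Emax ≤ K * N →
        Emax + Γ₀ < Eplus → Eplus ≤ L * N →
        A = gapCoeff N Eplus Emin Γ₀ Emin →
        -- the gap bound
        (0 < A ∧ ∀ g : ℝ, 0 < g → g ≤ Γ₀ →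
          Module.finrank ℂ (groundSpace (tfimHamiltonian J g)) = 1 ∧
          A ≤ gapCoeff N Eplus Emin Γ₀ (minEnergy (tfimHamiltonian J g)) ∧
          ∀ e ∈ energyLevels (tfimHamiltonian J g), e ≠ minEnergy (tfimHamiltonian J g) →
            gapCoeff N Eplus Emin Γ₀ (minEnergy (tfimHamiltonian J g)) * g ^ N
              ≤ e - minEnergy (tfimHamiltonian J g)) ∧
        -- the prefactor is of order `N⁰`
        (a₁ ≤ schedulePrefactor N A ∧ schedulePrefactor N A ≤ a₂) ∧
        ∃ C : ℝ, ∀ a : ℝ, schedulePrefactor N A ≤ a → ∀ δ : ℝ, 0 < δ →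
          -- for every `c`, all late enough starting times are admissible, and for every starting
          -- time all large enough `c` are admissible
          (∀ c : ℝ, ∀ᶠ t₀ in Filter.atTop,
            0 < δ * t₀ + c ∧ powerSchedule N a c δ t₀ ≤ Γ₀) ∧
          (∀ t₀ : ℝ, ∀ᶠ c in Filter.atTop,
            0 < δ * t₀ + c ∧ powerSchedule N a c δ t₀ ≤ Γ₀) ∧
          ∀ c t₀ : ℝ, 0 < t₀ → 0 < δ * t₀ + c → powerSchedule N a c δ t₀ ≤ Γ₀ →
            -- adiabaticity
            (∀ t : ℝ, t₀ < t →
              AdiabaticAt (fun s => tfimHamiltonian J (powerSchedule N a c δ s)) δ t) ∧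
            -- convergence of the Schrödinger evolution
            ∀ ψ : ℝ → StateSpace N,
              SolvesSchrodinger (fun s => tfimHamiltonian J (powerSchedule N a c δ s)) t₀ ψ →
              ‖ψ t₀‖ = 1 →
              (∀ t : ℝ, t₀ ≤ t →
                excitationAmplitude (tfimHamiltonian J (powerSchedule N a c δ t)) (ψ t) ≤
                  excitationAmplitude (tfimHamiltonian J (powerSchedule N a c δ t₀)) (ψ t₀)
                    + C * δ) ∧
              ∀ η : ℝ, 0 < η → ∀ᶠ t in Filter.atTop,
                excitationAmplitude (isingHamiltonian J) (ψ t) ≤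
                  excitationAmplitude (tfimHamiltonian J (powerSchedule N a c δ t₀)) (ψ t₀)
                    + C * δ + η := by
  obtain ⟨a₁, a₂, ha₁, hpre⟩ := schedulePrefactor_bounds K L Γ₀ hΓ₀
  refine ⟨a₁, a₂, ha₁, ?_⟩
  intro N hN J Emin Emax Eplus A hEmin hEmax hKmin hKmax hEplus hL hA
  obtain ⟨E, hE⟩ := exists_isingHamiltonian_eq J
  have htf : ∀ g, tfimHamiltonian J g = (realTfim E g).map Complex.ofRealHom := tfimHamiltonian_eq hE
  have hEm : ∀ x, Emin ≤ E x := fun x => by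
    rw [hEmin, hE]; exact (minEnergy_diagonal_le E x).1
  have hEp : ∀ x, Γ₀ ≤ Eplus - E x := fun x => by
    have := (minEnergy_diagonal_le E x).2
    rw [← hE, ← hEmax] at this
    linarith
  have hW : Γ₀ ≤ Eplus - Emin := (hEp 0).trans (by linarith [hEm 0])
  obtain ⟨hA0, hlow, hupp⟩ := hpre N hN Emin Eplus A hW hKmin hL hA
  have hN0 : (0 : ℝ) < N := by exact_mod_cast hN
  have hcoeff : ∀ g, A ≤ gapCoeff N Eplus Emin Γ₀ (groundEnergy E g) := fun g => by
    have hle : groundEnergy E g ≤ Emin := by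
      obtain ⟨x, hx⟩ := exists_le_minEnergy_diagonal E
      rw [hEmin, hE]
      exact (groundEnergy_le E g x).trans hx
    have hW0 : 0 < Eplus - Emin := hΓ₀.trans_le hW
    rw [hA, gapCoeff, gapCoeff]
    gcongr
  have hgap : ∀ g, 0 < g → g ≤ Γ₀ →
      ∀ e ∈ energyLevels ((realTfim E g).map Complex.ofRealHom), e ≠ groundEnergy E g →
        A * g ^ N ≤ e - groundEnergy E g := fun g hg hgΓ e he hne =>
    (mul_le_mul_of_nonneg_right (hcoeff g) (pow_pos hg N).le).trans
      (gapCoeff_mul_pow_le hN hg hgΓ hEp hEm he hne)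
  refine ⟨⟨hA0, fun g hg hgΓ => ?_⟩, ⟨hlow, hupp⟩, ?_⟩
  · rw [htf]
    exact ⟨finrank_groundSpace hN hg, hcoeff g, fun e he hne =>
      gapCoeff_mul_pow_le hN hg hgΓ hEp hEm he hne⟩
  obtain ⟨D, hD0, hD⟩ := exists_excitationAmplitude_le hN hΓ₀ hA0 hgap
  obtain ⟨κ, hκ, hising⟩ := exists_ising_excitationAmplitude_le hN E
  refine ⟨D * (A ^ 2 / N), fun a ha δ hδ => ?_⟩
  obtain ⟨ha0, hspeed⟩ := speed_mul_le hN hA0 hδ ha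
  refine ⟨fun c => ?_, fun t₀ => ?_, fun c t₀ ht₀ hpos hadm => ?_⟩
  · exact (Filter.tendsto_atTop_add_const_right _ c (Filter.tendsto_id.const_mul_atTop hδ)).eventually
      (eventually_admissible hN hΓ₀)
  · exact (Filter.tendsto_atTop_add_const_left _ (δ * t₀) Filter.tendsto_id).eventually
      (eventually_admissible hN hΓ₀)
  set β := δ / ((2 * N - 1) * a ^ (2 * N - 1)) with hβ
  have hm := one_le_two_mul_sub_one hN
  have hβ0 : 0 < β := by positivity
  have hlin : ∀ t, t₀ ≤ t → 0 < δ * t + c := fun t ht => by nlinarith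
  have hΓ' : ∀ t, t₀ ≤ t → HasDerivAt (powerSchedule N a c δ)
      (-(β * powerSchedule N a c δ t ^ (2 * N))) t := fun t ht =>
    hasDerivAt_powerSchedule hN ha0 (hlin t ht)
  have hΓ : ∀ t, t₀ ≤ t → 0 < powerSchedule N a c δ t ∧ powerSchedule N a c δ t ≤ Γ₀ :=
    fun t ht => ⟨powerSchedule_pos ha0 (hlin t ht),
      (powerSchedule_anti hN ha0 hδ hpos ht).trans hadm⟩
  have hfun : (fun s => tfimHamiltonian J (powerSchedule N a c δ s)) =
      fun s => (realTfim E (powerSchedule N a c δ s)).map Complex.ofRealHom :=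
    funext fun s => htf _
  rw [hfun]
  refine ⟨fun t ht => adiabaticAt_of_speed hN hA0 hβ0 hspeed (hΓ' t ht.le) (hΓ t ht.le).1
    (hgap _ (hΓ t ht.le).1 (hΓ t ht.le).2), fun ψ hψ hψ1 => ?_⟩
  have hmain := hD β t₀ (powerSchedule N a c δ) ψ hβ0 hΓ' hΓ hψ hψ1
  have hDβ : D * β ≤ D * (A ^ 2 / N) * δ := by
    rw [mul_assoc]
    refine mul_le_mul_of_nonneg_left ?_ hD0
    rw [div_mul_eq_mul_div, le_div_iff₀ hN0]
    linarith
  rw [htf, excitationAmplitude_realTfim hN (hΓ t₀ le_rfl).1]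
  refine ⟨fun t ht => ?_, fun η hη => ?_⟩
  · rw [htf, excitationAmplitude_realTfim hN (hΓ t ht).1]
    linarith [(hmain t ht).2]
  · have hsmall : Filter.Tendsto (fun t => √(powerSchedule N a c δ t * N / κ)) Filter.atTop (nhds 0) := by
      have h1 := (((tendsto_powerSchedule_time (a := a) (c := c) hN hδ).mul_const (N : ℝ)).div_const
        κ).sqrt
      simpa using h1
    filter_upwards [hsmall.eventually (eventually_le_nhds hη), Filter.eventually_ge_atTop t₀] with t h1 h2
    rw [hE]
    have h3 := hising _ (hΓ t h2).1 (ψ t) (hmain t h2).1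
    linarith [(hmain t h2).2]
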